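/- Let $V=\mathbb{C}^{\infty|\infty}$ be the complex super vector space with even basis $e_1,e_2,\dots$ and odd basis $f_1,f_2,\dots$, and write $[1]$ for the shift in super degree and $\epsilon$ for a basis vector of $\mathbb{C}[1]$. Let $A=\mathrm{Sym}(\mathrm{Sym}^2(V)[1])$ be the super symmetric algebra, i.e. the super polynomial ring over $\mathbb{C}$ in the variables $x_{i,j}=e_if_j\epsilon$ (super degree $0$), $y_{i,j}=y_{j,i}=e_ie_j\epsilon$ and $z_{i,j}=-z_{j,i}=f_if_j\epsilon$ (super degree $1$), with the induced action of $\mathrm{GL}_{\infty|\infty}$ (equivalently, of the Lie superalgebra $\mathfrak{gl}_{\infty|\infty}$, acting by super derivations). An ideal of $A$ regarded as a super tca means a super homogeneous ideal that is stable under this action. For a partition $\lambda$ let $\mathbf{S}_\lambda(V)$ denote the Schur functor applied to $V$, and let $n\times(n+1)$ denote the partition $(n+1,\dots,n+1)$ with $n$ parts. For $n\ge 1$ let $\mathfrak{p}_n\subset A$ be the ideal generated by the copy of $\mathbf{S}_{n\times(n+1)}(V)[n(n+1)/2]$ in $A$, that is, by the images of all $\mathrm{GL}_{\infty|\infty}$-equivariant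 maps $\mathbf{S}_{n\times(n+1)}(V)[n(n+1)/2]\to A$. Let $\mathfrak{m}$ be the ideal of the underlying algebra of $A$ generated by the $x_{i,j}$ with $i\ne j$, the $x_{i,i}-1$, the $y_{i,j}$ and the $z_{i,j}$ (this ideal is not $\mathrm{GL}_{\infty|\infty}$-stable). If $\mathfrak{a}$ is a non-zero ideal of the super tca $A$, then $\mathfrak{a}\supseteq\mathfrak{p}_n$ for some $n\ge 1$. In particular, $\mathfrak{a}+\mathfrak{m}=A$. -/

import Mathlib

noncomputable section

namespace SuperTca

/-! ### Super signs and the super vector space `V = ℂ^{∞|∞}` -/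

/-- The sign `(-1)^p` attached to a parity `p`. -/
def sgn (p : ZMod 2) : ℂ := if p = 0 then 1 else -1

theorem sgn_zero : sgn 0 = 1 := by simp [sgn]

theorem sgn_add (p q : ZMod 2) : sgn (p + q) = sgn p * sgn q := by
  have h : ∀ p : ZMod 2, p = 0 ∨ p = 1 := by decide
  have h2 : (1 : ZMod 2) + 1 = 0 := by decide
  rcases h p with rfl | rfl <;> rcases h q with rfl | rfl <;> simp only [sgn, h2] <;> simp

theorem sgn_mul_self (p : ZMod 2) : sgn p * sgn p = 1 := by
  unfold sgn; split_ifs <;> norm_num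

/-- The index set of the standard homogeneous basis of `V`:
`Sum.inl i` stands for the even vector `e_i`, `Sum.inr j` for the odd vector `f_j`
(indices start at `0`). -/
abbrev Idx : Type := ℕ ⊕ ℕ

/-- The parity of a basis vector of `V`. -/
def par : Idx → ZMod 2
  | Sum.inl _ => 0
  | Sum.inr _ => 1

/-! ### The algebra `A = Sym(Sym²(V)[1])` -/

/-- The super degree of the element `v_a v_b ε` of `Sym²(V)[1]`. -/
def gpar (c : Idx × Idx) : ZMod 2 := par c.1 + par c.2 + 1

/-- The defining relations of `Sym(Sym²(V)[1])` on the symbols `v_a v_b ε`: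
`v_b v_a = (-1)^{|a||b|} v_a v_b` in `Sym²(V)`, and super commutativity of the product. -/
inductive Rel : FreeAlgebra ℂ (Idx × Idx) → FreeAlgebra ℂ (Idx × Idx) → Prop
  | symm (a b : Idx) : Rel (FreeAlgebra.ι ℂ (b, a))
      (sgn (par a * par b) • FreeAlgebra.ι ℂ (a, b))
  | comm (c d : Idx × Idx) : Rel (FreeAlgebra.ι ℂ c * FreeAlgebra.ι ℂ d)
      (sgn (gpar c * gpar d) • (FreeAlgebra.ι ℂ d * FreeAlgebra.ι ℂ c))

/-- The super symmetric algebra `A = Sym(Sym²(V)[1])`, that is, the super polynomial ring in the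
variables `x_{i,j}`, `y_{i,j}`, `z_{i,j}` below. -/
def A : Type := RingQuot Rel

instance : Ring A := inferInstanceAs (Ring (RingQuot Rel))

instance : Algebra ℂ A := inferInstanceAs (Algebra ℂ (RingQuot Rel))

/-- The element `v_a v_b ε` of `A`. -/
def gen (c : Idx × Idx) : A := RingQuot.mkAlgHom ℂ Rel (FreeAlgebra.ι ℂ c)

theorem gen_symm (a b : Idx) : gen (b, a) = sgn (par a * par b) • gen (a, b) := by
  have h := RingQuot.mkAlgHom_rel ℂ (Rel.symm a b)
  rw [map_smul] at h
  exact h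

theorem gen_comm (c d : Idx × Idx) :
    gen c * gen d = sgn (gpar c * gpar d) • (gen d * gen c) := by
  have h := RingQuot.mkAlgHom_rel ℂ (Rel.comm c d)
  rw [map_smul, map_mul, map_mul] at h
  exact h

/-- The universal property of `A`. -/
def liftA {B : Type} [Ring B] [Algebra ℂ B] (f : Idx × Idx → B)
    (hs : ∀ a b, f (b, a) = sgn (par a * par b) • f (a, b))
    (hc : ∀ c d, f c * f d = sgn (gpar c * gpar d) • (f d * f c)) : A →ₐ[ℂ] B :=
  RingQuot.liftAlgHom ℂ ⟨FreeAlgebra.lift ℂ f, by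
    rintro _ _ (⟨a, b⟩ | ⟨c, d⟩)
    · simpa using hs a b
    · simpa using hc c d⟩

theorem liftA_gen {B : Type} [Ring B] [Algebra ℂ B] (f : Idx × Idx → B)
    (hs : ∀ a b, f (b, a) = sgn (par a * par b) • f (a, b))
    (hc : ∀ c d, f c * f d = sgn (gpar c * gpar d) • (f d * f c)) (c : Idx × Idx) :
    liftA f hs hc (gen c) = f c := by
  have h := RingQuot.liftAlgHom_mkAlgHom_apply (S := ℂ) (f := FreeAlgebra.lift ℂ f)
    (s := Rel) (w := by
      rintro _ _ (⟨a, b⟩ | ⟨c, d⟩)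
      · simpa using hs a b
      · simpa using hc c d) (x := FreeAlgebra.ι ℂ c)
  rw [FreeAlgebra.lift_ι_apply] at h
  exact h

theorem A_induction {P : A → Prop} (hr : ∀ r : ℂ, P (algebraMap ℂ A r)) (hg : ∀ c, P (gen c))
    (hm : ∀ s t, P s → P t → P (s * t)) (ha : ∀ s t, P s → P t → P (s + t)) (t : A) : P t := by
  obtain ⟨u, rfl⟩ := RingQuot.mkAlgHom_surjective ℂ Rel t
  induction u using FreeAlgebra.induction with
  | grade0 r => rw [AlgHom.commutes]; exact hr r
  | grade1 c => exact hg c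
  | mul s t hs ht => rw [map_mul]; exact hm _ _ hs ht
  | add s t hs ht => rw [map_add]; exact ha _ _ hs ht

/-- The automorphism of `A` which is `(-1)^{r p}` on the part of super degree `p`: the identity
for `r = 0` and the parity automorphism for `r = 1`. -/
def twist (r : ZMod 2) : A →ₐ[ℂ] A :=
  liftA (fun c => sgn (r * gpar c) • gen c)
    (fun a b => by
      rw [gen_symm a b, smul_comm]
      simp only [gpar, add_comm (par b)])
    (fun c d => by
      simp only [smul_mul_smul_comm]
      rw [gen_comm c d, smul_comm, mul_comm (sgn _)])

theorem twist_gen (r : ZMod 2) (c : Idx × Idx) :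
    twist r (gen c) = sgn (r * gpar c) • gen c := liftA_gen _ _ _ c

/-- The part of `A` of super degree `p`. -/
def superPart (p : ZMod 2) : Submodule ℂ A :=
  LinearMap.eqLocus (twist 1).toLinearMap (sgn p • LinearMap.id)

/-! ### The action of `𝔤𝔩_{∞|∞}` on `A` -/

/-- The elementary operator `E_{a,b} : v_b ↦ v_a` on `V` has parity `|a| + |b|`. -/
def opar (a b : Idx) : ZMod 2 := par a + par b

/-- The action of `E_{a,b}` on `Sym²(V)[1]`:
`E (v_c v_d ε) = E(v_c) v_d ε + (-1)^{|E||c|} v_c E(v_d) ε`. -/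
def genAct (a b : Idx) (c : Idx × Idx) : A :=
  (if c.1 = b then gen (a, c.2) else 0) +
    sgn (opar a b * par c.1) • (if c.2 = b then gen (c.1, a) else 0)

theorem genAct_symm (a b c d : Idx) :
    genAct a b (d, c) = sgn (par c * par d) • genAct a b (c, d) := by
  have key : ∀ u v : Idx, sgn (opar a u * par v) • gen (v, a)
      = sgn (par u * par v) • gen (a, v) := by
    intro u v
    rw [gen_symm a v, smul_smul]
    congr 1
    rw [opar, add_mul, sgn_add, mul_comm (sgn (par a * par v)), mul_assoc, sgn_mul_self, mul_one]
  have key' : ∀ u v : Idx, gen (a, v)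
      = sgn (par v * par u) • (sgn (opar a u * par v) • gen (v, a)) := by
    intro u v
    rw [key, smul_smul, mul_comm (par v), sgn_mul_self, one_smul]
  unfold genAct
  simp only [smul_add]
  rw [add_comm]
  congr 1
  · split_ifs with h
    · subst h; exact key c d
    · simp
  · split_ifs with h
    · subst h; exact key' d c
    · simp

theorem gpar_left (a b : Idx) (c : Idx × Idx) (h : c.1 = b) :
    gpar (a, c.2) = gpar c + opar a b := by
  subst h
  have : ∀ u v w : ZMod 2, u + v + 1 = w + v + 1 + (u + w) := by decide
  exact this _ _ _

theorem gpar_right (a b : Idx) (c : Idx × Idx) (h : c.2 = b) :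
    gpar (c.1, a) = gpar c + opar a b := by
  subst h
  have : ∀ u v w : ZMod 2, v + u + 1 = v + w + 1 + (u + w) := by decide
  exact this _ _ _

theorem gen_mul_genAct (a b : Idx) (c d : Idx × Idx) :
    gen c * genAct a b d = sgn (gpar c * (gpar d + opar a b)) • (genAct a b d * gen c) := by
  unfold genAct
  simp only [mul_add, add_mul, smul_add, mul_smul_comm, smul_mul_assoc]
  rw [smul_comm (sgn (gpar c * gpar d + gpar c * opar a b))]
  congr 1
  · split_ifs with h
    · rw [gen_comm, gpar_left a b d h, mul_add]
    · simp
  · congr 1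
    split_ifs with h
    · rw [gen_comm, gpar_right a b d h, mul_add]
    · simp

/-- The algebra homomorphism from `A` to upper triangular matrices whose upper right entry is the
action of `E_{a,b}` on `A`. -/
def actHom (a b : Idx) : A →ₐ[ℂ] Matrix (Fin 2) (Fin 2) A :=
  liftA (fun c => !![twist (opar a b) (gen c), genAct a b c; 0, gen c])
    (fun c d => by
      rw [gen_symm c d, genAct_symm, map_smul]
      ext i j; fin_cases i <;> fin_cases j <;> simp)
    (fun c d => by
      have h1 := gen_comm c d
      have h2 := gen_mul_genAct a b c d
      have h3 := gen_mul_genAct a b d c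
      have h4 : genAct a b c * gen d = sgn (gpar c * gpar d) •
          (sgn (opar a b * gpar d) • (gen d * genAct a b c)) := by
        rw [h3]
        simp only [smul_smul, ← mul_assoc]
        have : sgn (gpar c * gpar d) * sgn (opar a b * gpar d) *
            sgn (gpar d * (gpar c + opar a b)) = 1 := by
          rw [← sgn_add, ← sgn_add]
          have : ∀ u v w : ZMod 2, u * v + w * v + v * (u + w) = 0 := by decide
          rw [this, sgn_zero]
        rw [this, one_smul]
      have h5 : sgn (opar a b * gpar c) • (gen c * genAct a b d) =
          sgn (gpar c * gpar d) • (genAct a b d * gen c) := by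
        rw [h2, smul_smul]
        congr 1
        rw [← sgn_add]
        have : ∀ u v w : ZMod 2, w * u + u * (v + w) = u * v := by decide
        rw [this]
      have h6 : twist (opar a b) (gen c) * twist (opar a b) (gen d) =
          sgn (gpar c * gpar d) • (twist (opar a b) (gen d) * twist (opar a b) (gen c)) := by
        rw [← map_mul, ← map_mul, h1, map_smul]
      ext i j
      fin_cases i <;> fin_cases j
      · simpa using h6
      · simp only [twist_gen]
        simp only [Matrix.mul_fin_two]
        simp [h4, h5, add_comm]
      · simp
      · simpa using h1)

/-- The action of the elementary operator `E_{a,b} : v_b ↦ v_a` on `A`: the super derivation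
extending its action on `Sym²(V)[1]` (see `act_gen` and `act_mul`).  The operators `E_{a,b}` form
a basis of the Lie superalgebra `𝔤𝔩_{∞|∞}`. -/
def act (a b : Idx) : A →ₗ[ℂ] A where
  toFun t := actHom a b t 0 1
  map_add' s t := by simp
  map_smul' r t := by simp

theorem actHom_eq (a b : Idx) (t : A) :
    actHom a b t = !![twist (opar a b) t, act a b t; 0, t] := by
  refine A_induction (P := fun t => actHom a b t = !![twist (opar a b) t, act a b t; 0, t])
    ?_ ?_ ?_ ?_ t
  · intro r
    rw [AlgHom.commutes]
    ext i j
    fin_cases i <;> fin_cases j <;> simp [act, Matrix.algebraMap_matrix_apply]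
  · intro c
    have h : actHom a b (gen c) = _ := liftA_gen _ _ _ c
    have h' : act a b (gen c) = genAct a b c := by
      change actHom a b (gen c) 0 1 = _
      rw [h]; rfl
    rw [h, h']
  · intro s t hs ht
    have h' : act a b (s * t) = (actHom a b s * actHom a b t) 0 1 := by
      rw [← map_mul]; rfl
    rw [h', map_mul, hs, ht, Matrix.mul_fin_two]
    ext i j
    fin_cases i <;> fin_cases j <;> simp
  · intro s t hs ht
    rw [map_add, hs, ht]
    ext i j
    fin_cases i <;> fin_cases j <;> simp

theorem act_gen (a b : Idx) (c : Idx × Idx) : act a b (gen c) = genAct a b c := by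
  have h : actHom a b (gen c) = _ := liftA_gen _ _ _ c
  change actHom a b (gen c) 0 1 = _
  rw [h]; rfl

theorem act_mul (a b : Idx) (s t : A) :
    act a b (s * t) = act a b s * t + twist (opar a b) s * act a b t := by
  have h' : act a b (s * t) = (actHom a b s * actHom a b t) 0 1 := by
    rw [← map_mul]; rfl
  rw [h', actHom_eq, actHom_eq, Matrix.mul_fin_two]
  simp [add_comm]

/-! ### Ideals of `A` as a super tca, and the ideal `𝔪` of the underlying algebra -/

/-- Ideals of the super tca `A`: ideals of the underlying algebra which are subrepresentations,
that is, super homogeneous (stable under the parity automorphism) and stable under `𝔤𝔩_{∞|∞}`.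
(A super homogeneous left ideal of `A` is two-sided, since `A` is super commutative.) -/
structure IsTcaIdeal (I : Ideal A) : Prop where
  homogeneous : ∀ t ∈ I, twist 1 t ∈ I
  stable : ∀ a b : Idx, ∀ t ∈ I, act a b t ∈ I

/-- `x_{i,j} = e_i f_j ε`. -/
def x (i j : ℕ) : A := gen (Sum.inl i, Sum.inr j)

/-- `y_{i,j} = e_i e_j ε`. -/
def y (i j : ℕ) : A := gen (Sum.inl i, Sum.inl j)

/-- `z_{i,j} = f_i f_j ε`. -/
def z (i j : ℕ) : A := gen (Sum.inr i, Sum.inr j)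

/-- The ideal `𝔪` generated by the `x_{i,j}` with `i ≠ j`, the `x_{i,i} - 1`, the `y_{i,j}` and
the `z_{i,j}`. -/
def 𝔪 : Ideal A :=
  Ideal.span ({t | ∃ i j, i ≠ j ∧ t = x i j} ∪ {t | ∃ i, t = x i i - 1} ∪
    {t | ∃ i j, t = y i j} ∪ {t | ∃ i j, t = z i j})

/-! ### Tensor powers of `V` and Schur functors -/

section Tensor

variable {κ : Type} [Fintype κ] [LinearOrder κ]

/-- The tensor power of `V` with tensor factors in the positions `κ`, in its standard basis: the
function `w : κ → Idx` stands for the pure tensor of the vectors `v_{w k}`, in the order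
of `κ`. -/
abbrev Tens (κ : Type) : Type := (κ → Idx) →₀ ℂ

/-- The exponent of the Koszul sign for permuting the factors of the tensor `w` by `σ`: the sum of
`|w b| |w c|` over all inversions `(b, c)` of `σ`. -/
def koszul (σ : Equiv.Perm κ) (w : κ → Idx) : ZMod 2 :=
  ∑ b, ∑ c, if b < c ∧ σ c < σ b then par (w b) * par (w c) else 0

/-- The action of a permutation on the tensor power of the super vector space `V`: the factor in
position `k` moves to position `σ k`, with the Koszul sign. -/
def permAct (σ : Equiv.Perm κ) : Tens κ →ₗ[ℂ] Tens κ :=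
  Finsupp.linearCombination ℂ fun w => Finsupp.single (w ∘ σ.symm) (sgn (koszul σ w))

/-- The action of `E_{a,b}` on the tensor power: the sum over all `k` of `E_{a,b}` applied to the
factor in position `k`, with the sign `(-1)^{|E| p}` where `p` is the total parity of the factors
in the positions before `k`. -/
def tensAct (a b : Idx) : Tens κ →ₗ[ℂ] Tens κ :=
  Finsupp.linearCombination ℂ fun w => ∑ k, if w k = b then
    Finsupp.single (Function.update w k a)
      (sgn (opar a b * ∑ j, if j < k then par (w j) else 0)) else 0

/-- The part of the tensor power of super degree `p`. -/
def tensPart (p : ZMod 2) : Submodule ℂ (Tens κ) :=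
  Finsupp.supported ℂ ℂ {w : κ → Idx | ∑ k, par (w k) = p}

theorem koszul_update (σ : Equiv.Perm κ) (w : κ → Idx) (k : κ) (a : Idx) :
    koszul σ (Function.update w k a) = koszul σ w + opar a (w k) *
      ∑ j, if (j < k ∧ σ k < σ j) ∨ (k < j ∧ σ j < σ k) then par (w j) else 0 := by
  have hp : ∀ j, par (Function.update w k a j) =
      par (w j) + if j = k then opar a (w k) else 0 := by
    intro j
    by_cases h : j = k
    · subst h
      have : ∀ u v : ZMod 2, u = v + (u + v) := by decide
      simpa [opar] using this _ _
    · simp [h]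
  have hterm : ∀ b c, (if b < c ∧ σ c < σ b then
        par (Function.update w k a b) * par (Function.update w k a c) else 0) =
      (if b < c ∧ σ c < σ b then par (w b) * par (w c) else 0) +
      ((if b = k then (if k < c ∧ σ c < σ k then opar a (w k) * par (w c) else 0) else 0) +
       (if c = k then (if b < k ∧ σ k < σ b then opar a (w k) * par (w b) else 0) else 0)) := by
    intro b c
    rw [hp, hp]
    by_cases h1 : b = k <;> by_cases h2 : c = k
    · subst h1; subst h2; simp
    · subst h1; simp [h2]; split_ifs <;> ring
    · subst h2; simp [h1]; split_ifs <;> ring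
    · simp [h1, h2]
  unfold koszul
  simp only [hterm, Finset.sum_add_distrib]
  congr 1
  have e1 : (∑ b, ∑ c, (if b = k then
      (if k < c ∧ σ c < σ k then opar a (w k) * par (w c) else 0) else 0)) =
      ∑ c, (if k < c ∧ σ c < σ k then opar a (w k) * par (w c) else 0) := by
    rw [Finset.sum_comm]; simp
  have e2 : (∑ b, ∑ c, (if c = k then
      (if b < k ∧ σ k < σ b then opar a (w k) * par (w b) else 0) else 0)) =
      ∑ b, (if b < k ∧ σ k < σ b then opar a (w k) * par (w b) else 0) := by
    simp
  rw [e1, e2, ← Finset.sum_add_distrib, Finset.mul_sum]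
  refine Finset.sum_congr rfl fun j _ => ?_
  by_cases h : j < k
  · simp [h, not_lt.2 h.le]
  · simp [h]

theorem permAct_single (σ : Equiv.Perm κ) (w : κ → Idx) (r : ℂ) :
    permAct σ (Finsupp.single w r) = Finsupp.single (w ∘ σ.symm) (r * sgn (koszul σ w)) := by
  simp [permAct]

theorem tensAct_single (a b : Idx) (w : κ → Idx) (r : ℂ) :
    tensAct a b (Finsupp.single w r) = ∑ k, if w k = b then
      Finsupp.single (Function.update w k a)
        (r * sgn (opar a b * ∑ j, if j < k then par (w j) else 0)) else 0 := by
  simp [tensAct, Finset.smul_sum, smul_ite]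

/-- The symmetric group commutes with `𝔤𝔩_{∞|∞}` on the tensor power. -/
theorem permAct_tensAct (σ : Equiv.Perm κ) (a b : Idx) (t : Tens κ) :
    permAct σ (tensAct a b t) = tensAct a b (permAct σ t) := by
  induction t using Finsupp.induction_linear with
  | zero => simp
  | add s t hs ht => simp only [map_add, hs, ht]
  | single w r =>
    rw [permAct_single, tensAct_single, tensAct_single, map_sum]
    refine Fintype.sum_equiv σ _ _ fun k => ?_
    simp only [Function.comp_apply, Equiv.symm_apply_apply]
    split_ifs with h
    · subst h
      rw [permAct_single]
      have hw : Function.update w k a ∘ σ.symm = Function.update (w ∘ σ.symm) (σ k) a := by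
        funext j
        by_cases hj : j = σ k
        · subst hj; simp
        · have : σ.symm j ≠ k := fun h => hj (by simp [← h])
          simp [hj, this]
      rw [hw]
      congr 1
      rw [mul_assoc, mul_assoc, ← sgn_add, ← sgn_add]
      congr 2
      rw [koszul_update]
      have e : (∑ j, if j < σ k then par (w (σ.symm j)) else 0) =
          ∑ j, if σ j < σ k then par (w j) else 0 :=
        (Fintype.sum_equiv σ _ _ fun j => by simp).symm
      rw [e, add_left_comm, ← mul_add, ← Finset.sum_add_distrib]
      congr 2
      refine Finset.sum_congr rfl fun j _ => ?_
      rcases lt_trichotomy j k with hj | hj | hj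
      · have hne : σ j ≠ σ k := fun e => hj.ne (σ.injective e)
        rcases lt_or_gt_of_ne hne with h' | h'
        · simp [hj, h', not_lt.2 hj.le, not_lt.2 h'.le]
        · simp only [hj, h', not_lt.2 hj.le, not_lt.2 h'.le]
          have : ∀ u : ZMod 2, u + u = 0 := by decide
          simp [this]
      · subst hj; simp
      · have hne : σ j ≠ σ k := fun e => hj.ne' (σ.injective e)
        rcases lt_or_gt_of_ne hne with h' | h'
        · simp [hj, h', not_lt.2 hj.le, not_lt.2 h'.le]
        · simp [hj, h', not_lt.2 hj.le, not_lt.2 h'.le]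
    · simp

end Tensor

/-- The boxes of a Young diagram, ordered row by row. -/
abbrev Box (μ : YoungDiagram) : Type := {c : ℕ ×ₗ ℕ // ofLex c ∈ μ.cells}

instance (μ : YoungDiagram) : Fintype (Box μ) :=
  Fintype.subtype (μ.cells.map toLex.toEmbedding) (fun c => by simp)

/-- The row of a box. -/
def Box.row {μ : YoungDiagram} (c : Box μ) : ℕ := (ofLex c.1).1

/-- The column of a box. -/
def Box.col {μ : YoungDiagram} (c : Box μ) : ℕ := (ofLex c.1).2

/-- The Young symmetrizer of `μ` on the tensor power of `V`: symmetrize over the permutations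
preserving the rows, then antisymmetrize over the permutations preserving the columns. -/
def youngSymmetrizer (μ : YoungDiagram) : Tens (Box μ) →ₗ[ℂ] Tens (Box μ) :=
  (∑ σ : Equiv.Perm (Box μ) with ∀ c, (σ c).col = c.col,
      ((Equiv.Perm.sign σ : ℤ) : ℂ) • permAct σ) ∘ₗ
    (∑ σ : Equiv.Perm (Box μ) with ∀ c, (σ c).row = c.row, permAct σ)

/-- The Schur functor `S_μ(V)`, by Weyl's construction: the image of the Young symmetrizer on
the tensor power of `V` with `|μ|` factors. -/
def schur (μ : YoungDiagram) : Submodule ℂ (Tens (Box μ)) :=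
  LinearMap.range (youngSymmetrizer μ)

theorem tensAct_mem_schur (μ : YoungDiagram) (a b : Idx) :
    ∀ t ∈ schur μ, tensAct a b t ∈ schur μ := by
  rintro _ ⟨t, rfl⟩
  refine ⟨tensAct a b t, ?_⟩
  simp [youngSymmetrizer, permAct_tensAct]

/-- The action of `E_{a,b}` on `S_μ(V)`. -/
def schurAct (μ : YoungDiagram) (a b : Idx) : schur μ →ₗ[ℂ] schur μ :=
  (tensAct a b).restrict (tensAct_mem_schur μ a b)

/-- Morphisms of representations `S_μ(V)[k] → A`: linear maps on `S_μ(V)` which are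
`𝔤𝔩_{∞|∞}`-equivariant and carry super degree `p` to super degree `p + k`.  (The shift `[k]` is
the tensor product with `ε^k` on the right, so it introduces no sign in the action.) -/
structure IsSchurHom (μ : YoungDiagram) (k : ℕ) (φ : schur μ →ₗ[ℂ] A) : Prop where
  equivariant : ∀ (a b : Idx) (s : schur μ), φ (schurAct μ a b s) = act a b (φ s)
  parity : ∀ (p : ZMod 2) (s : schur μ), (s : Tens (Box μ)) ∈ tensPart p →
    φ s ∈ superPart (p + k)

/-- The copy of `S_μ(V)[k]` in `A`: the sum of the images of all morphisms `S_μ(V)[k] → A`. -/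
def schurPart (μ : YoungDiagram) (k : ℕ) : Submodule ℂ A :=
  ⨆ (φ : schur μ →ₗ[ℂ] A) (_ : IsSchurHom μ k φ), LinearMap.range φ

/-- The partition `n × k = (k, …, k)`, with `n` rows of length `k`. -/
def rect (n k : ℕ) : YoungDiagram where
  cells := Finset.range n ×ˢ Finset.range k
  isLowerSet := by
    rintro ⟨i, j⟩ ⟨i', j'⟩ ⟨hi, hj⟩ h
    simp at h hi hj ⊢
    omega

/-- The ideal `𝔭_n` of `A` generated by `S_{n × (n+1)}(V)[n(n+1)/2]`. -/
def 𝔭 (n : ℕ) : Ideal A :=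
  Ideal.span (schurPart (rect n (n + 1)) (n * (n + 1) / 2) : Set A)

end SuperTca

end

/-! The pivot is `yProd n`, the product of all `y_{i,j}` with `i ≤ j < n`: every nonzero tca ideal
contains one of these elements, and both conclusions follow from its membership.

Existence (`exists_yProd_mem`): a nonzero element of the ideal involves finitely many basis vectors.
The operators `E_{a,b}` with `a` a fresh even vector and `b = f_j` remove the odd vectors one at a
time. Nothing is lost, because applying `E_{b,a}` afterwards recovers `E_{b,b}`, which acts on a
weight vector by its multiplicity in `b`. What remains is a nonzero element in the odd variables
`y_{i,j}` alone, hence an element of an exterior algebra, where every nonzero element has the top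
product as a multiple.

Containment of `𝔭 n` (`𝔭_le_of_yProd_mem`): the Schur functor of the rectangle is generated by a
vector of weight `(n+1, …, n+1)` in the even directions (`schur_le`). An equivariant map sends it to
an element of `A` of that weight, and the total weight `n(n+1)` forces top degree in the `y_{i,j}`,
so the image is a scalar multiple of `yProd n` (`eq_smul_yProd`). Equivariance then puts the whole
image in the ideal.

Comaximality with `𝔪`: it suffices to find an element of the ideal that does not vanish at the point
`ev` with `x_{i,i} = 1` and all other variables zero. The operator replacing `e_j` by `f_i` turns
`y_{i,j}` into a nonzero constant at the point and every other factor into something vanishing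
there, so applying one such operator per factor to `yProd n` gives a nonzero value
(`exists_ev_ne_zero`). -/

noncomputable section

namespace SuperTca

/-! ### Subalgebras of `A` on a set of indices -/

/-- The subalgebra of `A` generated by the `v_a v_b ε` with `a, b ∈ S`. -/
def onIdx (S : Set Idx) : Subalgebra ℂ A :=
  Algebra.adjoin ℂ (gen '' {c | c.1 ∈ S ∧ c.2 ∈ S})

theorem gen_mem_onIdx {S : Set Idx} {a b : Idx} (ha : a ∈ S) (hb : b ∈ S) :
    gen (a, b) ∈ onIdx S :=
  Algebra.subset_adjoin ⟨(a, b), ⟨ha, hb⟩, rfl⟩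

theorem onIdx_mono {S T : Set Idx} (h : S ⊆ T) : onIdx S ≤ onIdx T :=
  Algebra.adjoin_mono (Set.image_mono fun _ hc => ⟨h hc.1, h hc.2⟩)

theorem exists_finset_mem_onIdx (t : A) : ∃ S : Finset Idx, t ∈ onIdx (S : Set Idx) := by
  classical
  have hl : ∀ S T : Finset Idx, onIdx (S : Set Idx) ≤ onIdx ((S ∪ T : Finset Idx) : Set Idx) :=
    fun S T => onIdx_mono (by simp)
  have hr : ∀ S T : Finset Idx, onIdx (T : Set Idx) ≤ onIdx ((S ∪ T : Finset Idx) : Set Idx) :=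
    fun S T => onIdx_mono (by simp)
  induction t using A_induction with
  | hr r => exact ⟨∅, Subalgebra.algebraMap_mem _ r⟩
  | hg c => exact ⟨{c.1, c.2}, gen_mem_onIdx (by simp) (by simp)⟩
  | hm s t hs ht =>
    obtain ⟨S, hS⟩ := hs
    obtain ⟨T, hT⟩ := ht
    exact ⟨S ∪ T, mul_mem (hl S T hS) (hr S T hT)⟩
  | ha s t hs ht =>
    obtain ⟨S, hS⟩ := hs
    obtain ⟨T, hT⟩ := ht
    exact ⟨S ∪ T, add_mem (hl S T hS) (hr S T hT)⟩

theorem act_algebraMap (a b : Idx) (r : ℂ) : act a b (algebraMap ℂ A r) = 0 := by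
  change actHom a b (algebraMap ℂ A r) 0 1 = 0
  rw [AlgHom.commutes]
  simp [Matrix.algebraMap_matrix_apply]

theorem twist_zero (t : A) : twist 0 t = t := by
  induction t using A_induction with
  | hr r => exact AlgHom.commutes _ _
  | hg c => simp [twist_gen, sgn_zero]
  | hm s t hs ht => rw [map_mul, hs, ht]
  | ha s t hs ht => rw [map_add, hs, ht]

theorem twist_twist (r : ZMod 2) (t : A) : twist r (twist r t) = t := by
  induction t using A_induction with
  | hr c => simp
  | hg c => simp [twist_gen, smul_smul, sgn_mul_self]
  | hm s t hs ht => simp only [map_mul, hs, ht]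
  | ha s t hs ht => simp only [map_add, hs, ht]

theorem opar_self (b : Idx) : opar b b = 0 := CharTwo.add_self_eq_zero _

theorem opar_comm (a b : Idx) : opar a b = opar b a := add_comm _ _

theorem act_self_mul (b : Idx) (s t : A) :
    act b b (s * t) = act b b s * t + s * act b b t := by
  rw [act_mul, opar_self, twist_zero]

theorem twist_adjoin {S : Set A} (h : ∀ s ∈ S, ∃ r : ℂ, twist 1 s = r • s) {t : A}
    (ht : t ∈ Algebra.adjoin ℂ S) : twist 1 t ∈ Algebra.adjoin ℂ S := by
  induction ht using Algebra.adjoin_induction with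
  | mem s hs =>
    obtain ⟨r, hr⟩ := h s hs
    rw [hr]
    exact Subalgebra.smul_mem _ (Algebra.subset_adjoin hs) r
  | algebraMap r => rw [AlgHom.commutes]; exact Subalgebra.algebraMap_mem _ r
  | add s t _ _ hs ht => rw [map_add]; exact add_mem hs ht
  | mul s t _ _ hs ht => rw [map_mul]; exact mul_mem hs ht

theorem twist_mem_onIdx {S : Set Idx} (r : ZMod 2) {t : A} (ht : t ∈ onIdx S) :
    twist r t ∈ onIdx S := by
  have h : r = 0 ∨ r = 1 := by revert r; decide
  rcases h with rfl | rfl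
  · rwa [twist_zero]
  · refine twist_adjoin ?_ ht
    rintro _ ⟨c, -, rfl⟩
    exact ⟨_, twist_gen 1 c⟩

theorem act_mem_onIdx {S T : Set Idx} (hST : S ⊆ T) {a : Idx} (ha : a ∈ T) (b : Idx) {t : A}
    (ht : t ∈ onIdx S) : act a b t ∈ onIdx T := by
  induction ht using Algebra.adjoin_induction with
  | mem s hs =>
    obtain ⟨c, ⟨h1, h2⟩, rfl⟩ := hs
    rw [act_gen, genAct]
    refine add_mem ?_ (Subalgebra.smul_mem _ ?_ _)
    · split_ifs
      · exact gen_mem_onIdx ha (hST h2)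
      · exact zero_mem _
    · split_ifs
      · exact gen_mem_onIdx (hST h1) ha
      · exact zero_mem _
  | algebraMap r => rw [act_algebraMap]; exact zero_mem _
  | add s t _ _ hs ht => rw [map_add]; exact add_mem hs ht
  | mul s t hs' ht' hs ht =>
    rw [act_mul]
    exact add_mem (mul_mem hs (onIdx_mono hST ht'))
      (mul_mem (twist_mem_onIdx _ (onIdx_mono hST hs')) ht)

theorem act_eq_zero_of_notMem {S : Set Idx} (a : Idx) {b : Idx} (hb : b ∉ S) {t : A}
    (ht : t ∈ onIdx S) : act a b t = 0 := by
  induction ht using Algebra.adjoin_induction with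
  | mem s hs =>
    obtain ⟨c, ⟨h1, h2⟩, rfl⟩ := hs
    have e1 : c.1 ≠ b := fun h => hb (h ▸ h1)
    have e2 : c.2 ≠ b := fun h => hb (h ▸ h2)
    simp [act_gen, genAct, e1, e2]
  | algebraMap r => exact act_algebraMap _ _ _
  | add s t _ _ hs ht => rw [map_add, hs, ht, add_zero]
  | mul s t _ _ hs ht => rw [act_mul, hs, ht, mul_zero, zero_mul, add_zero]

/-- Replacing `b` by a new index `a` and then back again is the same as `E_{b,b}`. -/
theorem act_act_of_notMem {S : Set Idx} {a : Idx} (ha : a ∉ S) (b : Idx) {t : A}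
    (ht : t ∈ onIdx S) : act b a (act a b t) = act b b t := by
  induction ht using Algebra.adjoin_induction with
  | mem s hs =>
    obtain ⟨c, ⟨h1, h2⟩, rfl⟩ := hs
    have e1 : c.1 ≠ a := fun h => ha (h ▸ h1)
    have e2 : c.2 ≠ a := fun h => ha (h ▸ h2)
    have h3 : act b a (if c.1 = b then gen (a, c.2) else 0) =
        if c.1 = b then gen (b, c.2) else 0 := by
      split_ifs
      · simp [act_gen, genAct, e2]
      · simp
    have h4 : act b a (if c.2 = b then gen (c.1, a) else 0) =
        sgn (opar a b * par c.1) • if c.2 = b then gen (c.1, b) else 0 := by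
      split_ifs
      · simp [act_gen, genAct, e1, opar_comm b a]
      · simp
    rw [act_gen, act_gen, genAct, map_add, map_smul, h3, h4, smul_smul, sgn_mul_self, genAct,
      opar_self, zero_mul, sgn_zero]
  | algebraMap r => simp only [act_algebraMap, map_zero]
  | add s t _ _ hs ht => simp only [map_add, hs, ht]
  | mul s t hs' ht' hs ht =>
    -- The cross terms of the double Leibniz expansion contain `E_{b,a}` applied to `t` or to a
    -- twist of `s`, neither of which involves `a`; the two twists left on `s` cancel.
    rw [act_mul, map_add, act_mul, act_mul, hs, ht, act_eq_zero_of_notMem b ha ht',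
      act_eq_zero_of_notMem b ha (twist_mem_onIdx _ hs'), opar_comm b a, twist_twist,
      act_self_mul, mul_zero, zero_mul, add_zero, zero_add]

theorem act_self_twist (b : Idx) (r : ZMod 2) (t : A) :
    act b b (twist r t) = twist r (act b b t) := by
  induction t using A_induction with
  | hr c => simp [act_algebraMap]
  | hg c =>
    rw [twist_gen, map_smul, act_gen, genAct, opar_self, zero_mul, sgn_zero, one_smul, map_add,
      smul_add]
    congr 1
    · split_ifs with h
      · subst h; exact (twist_gen _ _).symm
      · simp
    · split_ifs with h
      · subst h; exact (twist_gen _ _).symm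
      · simp
  | hm s t hs ht => simp only [map_mul, act_self_mul, hs, ht, map_add]
  | ha s t hs ht => simp only [map_add, hs, ht]

/-- The bracket `[E_{b,b}, E_{a,b}] = -E_{a,b}`: the operator `E_{a,b}` lowers the `b`-weight by
one. This drives the induction on the weight in `exists_mem_onIdx_evens`. -/
theorem act_self_act {a b : Idx} (hab : a ≠ b) (t : A) :
    act b b (act a b t) = act a b (act b b t) - act a b t := by
  induction t using A_induction with
  | hr c => simp [act_algebraMap]
  | hg c =>
    obtain ⟨c, d⟩ := c
    by_cases h1 : c = b <;> by_cases h2 : d = b <;>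
      simp [act_gen, genAct, h1, h2, hab, opar_self, sgn_zero]
  | hm s t hs ht =>
    simp only [act_mul a b, act_self_mul, map_add, hs, ht, act_self_twist]
    noncomm_ring
  | ha s t hs ht => simp only [map_add, hs, ht]; abel

/-! ### Weights -/

/-- The polynomial `T (T - 1) ⋯ (T - (k - 1))`. -/
def fallPoly (k : ℕ) : Polynomial ℂ :=
  ∏ i ∈ Finset.range k, (Polynomial.X - Polynomial.C (i : ℂ))

theorem fallPoly_succ (k : ℕ) :
    fallPoly (k + 1) = (Polynomial.X - Polynomial.C (k : ℂ)) * fallPoly k := by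
  rw [fallPoly, Finset.prod_range_succ, mul_comm]; rfl

theorem fallPoly_dvd {k l : ℕ} (h : k ≤ l) : fallPoly k ∣ fallPoly l :=
  Finset.prod_dvd_prod_of_subset _ _ _ (Finset.range_mono h)

theorem aeval_eigen {M : Type*} [AddCommGroup M] [Module ℂ M] {T : Module.End ℂ M} {v : M}
    {r : ℂ} (h : T v = r • v) (p : Polynomial ℂ) : Polynomial.aeval T p v = p.eval r • v := by
  induction p using Polynomial.induction_on' with
  | add p q hp hq => simp [hp, hq, add_smul]
  | monomial n c =>
    have : (T ^ n) v = r ^ n • v := by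
      induction n with
      | zero => simp
      | succ n ih => rw [pow_succ', Module.End.mul_apply, ih, map_smul, h, smul_smul, pow_succ]
    simp [Polynomial.aeval_monomial, this, smul_smul, mul_comm]

theorem aeval_eq_zero_of_dvd {M : Type*} [AddCommGroup M] [Module ℂ M] {T : Module.End ℂ M}
    {v : M} {p q : Polynomial ℂ} (h : p ∣ q) (hp : Polynomial.aeval T p v = 0) :
    Polynomial.aeval T q v = 0 := by
  obtain ⟨r, rfl⟩ := h
  rw [mul_comm, map_mul, Module.End.mul_apply, hp, map_zero]

theorem fallPoly_eval_eq_zero {j k : ℕ} (h : j < k) : (fallPoly k).eval (j : ℂ) = 0 := by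
  rw [fallPoly, Polynomial.eval_prod]
  exact Finset.prod_eq_zero (Finset.mem_range.2 h) (by simp)

theorem fallPoly_eval_ne_zero (k : ℕ) : (fallPoly k).eval (k : ℂ) ≠ 0 := by
  rw [fallPoly, Polynomial.eval_prod, Finset.prod_ne_zero_iff]
  intro i hi
  have : i < k := Finset.mem_range.1 hi
  simp [sub_eq_zero, this.ne']

/-- A nonzero vector killed by a product of `T - i` gives an eigenvector with natural
eigenvalue in every invariant subspace containing it. -/
theorem exists_eigen {M : Type*} [AddCommGroup M] [Module ℂ M] {T : Module.End ℂ M}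
    {W : Submodule ℂ M} (hW : ∀ v ∈ W, T v ∈ W) {v : M} (hv : v ∈ W) (h0 : v ≠ 0) {k : ℕ}
    (hk : Polynomial.aeval T (fallPoly k) v = 0) :
    ∃ (j : ℕ) (u : M), u ∈ W ∧ u ≠ 0 ∧ T u = (j : ℂ) • u := by
  induction k with
  | zero => simp [fallPoly, h0] at hk
  | succ k ih =>
    by_cases h : Polynomial.aeval T (fallPoly k) v = 0
    · exact ih h
    -- The shorter product applied to `v` is nonzero and is killed by the last factor `T - k`, so it
    -- is itself the eigenvector.
    · refine ⟨k, _, ?_, h, ?_⟩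
      · clear ih hk h
        induction k with
        | zero => simpa [fallPoly] using hv
        | succ k ih =>
          rw [fallPoly_succ, map_mul, Module.End.mul_apply, map_sub, Polynomial.aeval_X,
            Polynomial.aeval_C, LinearMap.sub_apply, Module.algebraMap_end_apply]
          exact sub_mem (hW _ ih) (W.smul_mem _ ih)
      · rw [fallPoly_succ, map_mul, Module.End.mul_apply, map_sub, Polynomial.aeval_X,
          Polynomial.aeval_C, LinearMap.sub_apply, Module.algebraMap_end_apply, sub_eq_zero] at hk
        exact hk

theorem onIdx_induction {S : Set Idx} {P : A → Prop}
    (hm : ∀ m ∈ Submonoid.closure (gen '' {c | c.1 ∈ S ∧ c.2 ∈ S}), P m) (h0 : P 0)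
    (ha : ∀ s t, P s → P t → P (s + t)) (hs : ∀ (r : ℂ) t, P t → P (r • t)) {t : A}
    (ht : t ∈ onIdx S) : P t := by
  have h : t ∈ Subalgebra.toSubmodule (onIdx S) := ht
  rw [onIdx, Algebra.adjoin_eq_span] at h
  refine Submodule.span_induction (p := fun t _ => P t) (fun m h => hm m h) h0
    (fun s t _ _ h1 h2 => ha s t h1 h2) (fun r t _ h => hs r t h) h

/-- A monomial of `A` is a weight vector. -/
theorem monomial_weight {S : Set Idx} (b : Idx) {m : A}
    (hm : m ∈ Submonoid.closure (gen '' {c | c.1 ∈ S ∧ c.2 ∈ S})) :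
    ∃ k : ℕ, act b b m = (k : ℂ) • m ∧ (k = 0 → m ∈ onIdx (S \ {b})) := by
  induction hm using Submonoid.closure_induction with
  | mem s hs =>
    obtain ⟨⟨c, d⟩, ⟨h1, h2⟩, rfl⟩ := hs
    refine ⟨(if c = b then 1 else 0) + (if d = b then 1 else 0), ?_, ?_⟩
    · by_cases e1 : c = b <;> by_cases e2 : d = b <;>
        simp [act_gen, genAct, opar_self, sgn_zero, e1, e2, two_smul]
    · intro h
      have e1 : c ≠ b := by rintro rfl; simp at h
      have e2 : d ≠ b := by rintro rfl; simp at h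
      exact gen_mem_onIdx ⟨h1, e1⟩ ⟨h2, e2⟩
  | one => exact ⟨0, by simpa using act_algebraMap b b 1, fun _ => one_mem _⟩
  | mul s t _ _ hs ht =>
    obtain ⟨k, hk, hk'⟩ := hs
    obtain ⟨l, hl, hl'⟩ := ht
    refine ⟨k + l, ?_, fun h => ?_⟩
    · rw [act_self_mul, hk, hl, Nat.cast_add, add_smul, smul_mul_assoc, mul_smul_comm]
    · exact mul_mem (hk' (by omega)) (hl' (by omega))

/-- Each element is a finite combination of monomials, which are eigenvectors with natural number
eigenvalues, so a long enough falling product annihilates it. -/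
theorem exists_fallPoly_eq_zero (b : Idx) (t : A) :
    ∃ k, Polynomial.aeval (act b b) (fallPoly k) t = 0 := by
  obtain ⟨S, hS⟩ := exists_finset_mem_onIdx t
  refine onIdx_induction (P := fun t => ∃ k, Polynomial.aeval (act b b) (fallPoly k) t = 0)
    ?_ ?_ ?_ ?_ hS
  · intro m hm
    obtain ⟨k, hk, -⟩ := monomial_weight b hm
    exact ⟨k + 1, by rw [aeval_eigen hk, fallPoly_eval_eq_zero k.lt_succ_self, zero_smul]⟩
  · exact ⟨0, map_zero _⟩
  · rintro s t ⟨k, hk⟩ ⟨l, hl⟩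
    exact ⟨max k l, by rw [map_add, aeval_eq_zero_of_dvd (fallPoly_dvd (le_max_left _ _)) hk,
      aeval_eq_zero_of_dvd (fallPoly_dvd (le_max_right _ _)) hl, add_zero]⟩
  · rintro r t ⟨k, hk⟩
    exact ⟨k, by rw [map_smul, hk, smul_zero]⟩

/-- An element of weight zero for `b` does not involve `b`. -/
theorem mem_onIdx_diff {S : Set Idx} (b : Idx) {t : A} (ht : t ∈ onIdx S)
    (h : act b b t = 0) : t ∈ onIdx (S \ {b}) := by
  -- Sort the monomials by `b`-weight: those of weight zero avoid `b` and form `u`, the others form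
  -- `v`. Then `v` has weight zero as well, so independence of the eigenspaces gives `v = 0`.
  obtain ⟨u, hu, v, hv, rfl⟩ : ∃ u ∈ onIdx (S \ {b}), ∃ v,
      v ∈ (⨆ (r : ℂ) (_ : r ≠ 0), Module.End.eigenspace (act b b) r) ∧ t = u + v := by
    refine onIdx_induction (P := fun t => ∃ u ∈ onIdx (S \ {b}), ∃ v,
      v ∈ (⨆ (r : ℂ) (_ : r ≠ 0), Module.End.eigenspace (act b b) r) ∧ t = u + v)
      ?_ ?_ ?_ ?_ ht
    · intro m hm
      obtain ⟨k, hk, hk'⟩ := monomial_weight b hm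
      by_cases hk0 : k = 0
      · exact ⟨m, hk' hk0, 0, zero_mem _, (add_zero m).symm⟩
      · exact ⟨0, zero_mem _, m, Submodule.mem_iSup_of_mem (k : ℂ)
          (Submodule.mem_iSup_of_mem (by exact_mod_cast hk0) (Module.End.mem_eigenspace_iff.2 hk)), (zero_add m).symm⟩
    · exact ⟨0, zero_mem _, 0, zero_mem _, (add_zero 0).symm⟩
    · rintro _ _ ⟨u, hu, v, hv, rfl⟩ ⟨u', hu', v', hv', rfl⟩
      exact ⟨u + u', add_mem hu hu', v + v', add_mem hv hv', by abel⟩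
    · rintro r _ ⟨u, hu, v, hv, rfl⟩
      exact ⟨r • u, Subalgebra.smul_mem _ hu r, r • v, Submodule.smul_mem _ r hv, smul_add _ _ _⟩
  have h0 : act b b v = (0 : ℂ) • v := by
    rw [map_add, act_eq_zero_of_notMem b (by simp) hu, zero_add] at h
    rw [h, zero_smul]
  have hd := (Module.End.eigenspaces_iSupIndep (act b b)) 0
  rw [Submodule.disjoint_def.1 hd v (Module.End.mem_eigenspace_iff.2 h0) hv, add_zero]
  exact hu

/-! ### Elimination of the odd basis vectors -/

/-- The set of the first `N` even basis vectors. -/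
def evens (N : ℕ) : Set Idx := {c | ∃ i < N, c = Sum.inl i}

/-- The set of the odd basis vectors with index in `B`. -/
def odds (B : Finset ℕ) : Set Idx := {c | ∃ j ∈ B, c = Sum.inr j}

theorem evens_mono {M N : ℕ} (h : M ≤ N) : evens M ⊆ evens N := by
  rintro _ ⟨i, hi, rfl⟩
  exact ⟨i, hi.trans_le h, rfl⟩

/-- Replacing all odd basis vectors by new even ones. -/
theorem exists_mem_onIdx_evens {W : Submodule ℂ A} (hW : ∀ a b, ∀ t ∈ W, act a b t ∈ W)
    (B : Finset ℕ) : ∀ (N : ℕ) (t : A), t ∈ W → t ≠ 0 → t ∈ onIdx (evens N ∪ odds B) →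
      ∃ (M : ℕ) (u : A), u ∈ W ∧ u ≠ 0 ∧ u ∈ onIdx (evens M) := by
  classical
  induction B using Finset.induction_on with
  | empty =>
    intro N t ht h0 hN
    exact ⟨N, t, ht, h0, by simpa [odds] using hN⟩
  | insert j B _ ih =>
    -- For a weight vector, induct on the multiplicity `k` of `f_j`; at `k = 0` the element no
    -- longer involves `f_j`.
    have key : ∀ (k N : ℕ) (t : A), t ∈ W → t ≠ 0 → t ∈ onIdx (evens N ∪ odds (insert j B)) →
        act (Sum.inr j) (Sum.inr j) t = (k : ℂ) • t →
        ∃ (M : ℕ) (u : A), u ∈ W ∧ u ≠ 0 ∧ u ∈ onIdx (evens M) := by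
      intro k
      induction k with
      | zero =>
        intro N t ht h0 hN hk
        refine ih N t ht h0 (onIdx_mono ?_ (mem_onIdx_diff _ hN (by simpa using hk)))
        rintro c ⟨h | ⟨i, hi, rfl⟩, hc⟩
        · exact Or.inl h
        · refine Or.inr ⟨i, ?_, rfl⟩
          rcases Finset.mem_insert.1 hi with rfl | hi
          · exact absurd rfl hc
          · exact hi
      | succ k ihk =>
        intro N t ht h0 hN hk
        -- The vector `e_N` is fresh, so going back from `e_N` to `f_j` yields `(k + 1) • t ≠ 0`;
        -- hence the new element is nonzero.
        refine ihk (N + 1) (act (Sum.inl N) (Sum.inr j) t) (hW _ _ _ ht) ?_ ?_ ?_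
        · intro h
          have h1 := act_act_of_notMem (a := Sum.inl N) (by simp [evens, odds]) (Sum.inr j) hN
          rw [h, map_zero, hk] at h1
          exact smul_ne_zero (by exact_mod_cast k.succ_ne_zero) h0 h1.symm
        · exact act_mem_onIdx (Set.union_subset_union_left _ (evens_mono N.le_succ))
            (Or.inl ⟨N, N.lt_succ_self, rfl⟩) _ hN
        · rw [act_self_act (by simp), hk, map_smul]
          push_cast
          module
    intro N t ht h0 hN
    obtain ⟨k, hk⟩ := exists_fallPoly_eq_zero (Sum.inr j) t
    -- A general `t` need not be a weight vector; replace it by an eigenvector inside `W` that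
    -- involves no further indices.
    have hS : ∀ v ∈ W ⊓ Subalgebra.toSubmodule (onIdx (evens N ∪ odds (insert j B))),
        act (Sum.inr j) (Sum.inr j) v ∈
          W ⊓ Subalgebra.toSubmodule (onIdx (evens N ∪ odds (insert j B))) :=
      fun v hv => ⟨hW _ _ _ hv.1, act_mem_onIdx subset_rfl
        (Or.inr ⟨j, Finset.mem_insert_self j B, rfl⟩) _ hv.2⟩
    obtain ⟨l, u, ⟨hu, hu'⟩, hu0, hl⟩ := exists_eigen hS ⟨ht, hN⟩ h0 hk
    exact key l N u hu hu0 hu' hl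

theorem exists_subset_evens_union_odds (S : Finset Idx) :
    ∃ (N : ℕ) (B : Finset ℕ), (S : Set Idx) ⊆ evens N ∪ odds B := by
  classical
  induction S using Finset.induction_on with
  | empty => exact ⟨0, ∅, by simp⟩
  | insert c S _ ih =>
    obtain ⟨N, B, h⟩ := ih
    rcases c with i | j
    · refine ⟨max N (i + 1), B, ?_⟩
      rw [Finset.coe_insert, Set.insert_subset_iff]
      exact ⟨Or.inl ⟨i, by omega, rfl⟩,
        h.trans (Set.union_subset_union_left _ (evens_mono (le_max_left _ _)))⟩
    · refine ⟨N, insert j B, ?_⟩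
      rw [Finset.coe_insert, Set.insert_subset_iff]
      refine ⟨Or.inr ⟨j, Finset.mem_insert_self j B, rfl⟩, h.trans ?_⟩
      refine Set.union_subset_union_right _ ?_
      rintro _ ⟨i, hi, rfl⟩
      exact ⟨i, Finset.mem_insert_of_mem hi, rfl⟩

/-- An element of weight zero for all `b` outside of `T` only involves `T`. -/
theorem mem_onIdx_of_weight_zero {T : Set Idx} {t : A} (h : ∀ b ∉ T, act b b t = 0) :
    t ∈ onIdx T := by
  classical
  obtain ⟨S, hS⟩ := exists_finset_mem_onIdx t
  have h1 : t ∈ onIdx (T ∪ (S : Set Idx)) := onIdx_mono Set.subset_union_right hS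
  clear hS
  induction S using Finset.induction_on with
  | empty => simpa using h1
  | insert c S _ ih =>
    refine ih ?_
    by_cases hc : c ∈ T
    · refine onIdx_mono ?_ h1
      rw [Finset.coe_insert, Set.union_insert]
      exact Set.insert_subset (Or.inl hc) subset_rfl
    · refine onIdx_mono ?_ (mem_onIdx_diff c h1 (h c hc))
      rw [Finset.coe_insert, Set.union_insert]
      rintro d ⟨rfl | hd, hd'⟩
      · exact absurd rfl hd'
      · exact hd

/-! ### Polynomials in odd variables -/

theorem odd_gen_mul {c : Idx × Idx} (hc : gpar c = 1) (t : A) :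
    gen c * t = twist 1 t * gen c := by
  induction t using A_induction with
  | hr r => rw [AlgHom.commutes]; exact (Algebra.commutes r _).symm
  | hg d => rw [gen_comm, twist_gen, hc, smul_mul_assoc]
  | hm s t hs ht => rw [← mul_assoc, hs, mul_assoc, ht, map_mul, mul_assoc]
  | ha s t hs ht => rw [mul_add, hs, ht, map_add, add_mul]

theorem odd_gen_mul_self {c : Idx × Idx} (hc : gpar c = 1) : gen c * gen c = 0 := by
  have h := odd_gen_mul hc (gen c)
  have h1 : sgn 1 = -1 := by simp [sgn]
  rw [twist_gen, hc, mul_one, h1, neg_one_smul, neg_mul] at h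
  have h2 : (2 : ℂ) • (gen c * gen c) = 0 := by
    rw [two_smul]
    exact add_eq_zero_iff_eq_neg.2 h
  exact (smul_eq_zero.1 h2).resolve_left two_ne_zero

theorem odd_gen_mul_mul_self {c : Idx × Idx} (hc : gpar c = 1) (t : A) :
    gen c * t * gen c = 0 := by
  rw [odd_gen_mul hc, mul_assoc, odd_gen_mul_self hc, mul_zero]

/-- The subalgebra generated by the variables in a list. -/
def onList (l : List (Idx × Idx)) : Subalgebra ℂ A := Algebra.adjoin ℂ (gen '' {c | c ∈ l})

theorem twist_mem_onList {l : List (Idx × Idx)} {t : A} (ht : t ∈ onList l) :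
    twist 1 t ∈ onList l := by
  refine twist_adjoin ?_ ht
  rintro _ ⟨c, -, rfl⟩
  exact ⟨_, twist_gen 1 c⟩

/-- An odd variable squares to zero and moves past anything at the cost of a twist, so an element is
at most linear in it. No uniqueness of the decomposition is needed. -/
theorem onList_cons {c : Idx × Idx} (hc : gpar c = 1) {l : List (Idx × Idx)} {t : A}
    (ht : t ∈ onList (c :: l)) : ∃ g ∈ onList l, ∃ h ∈ onList l, t = g + gen c * h := by
  induction ht using Algebra.adjoin_induction with
  | mem s hs =>
    obtain ⟨d, hd, rfl⟩ := hs
    rcases List.mem_cons.1 hd with rfl | hd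
    · exact ⟨0, zero_mem _, 1, one_mem _, by simp⟩
    · exact ⟨gen d, Algebra.subset_adjoin ⟨d, hd, rfl⟩, 0, zero_mem _, by simp⟩
  | algebraMap r => exact ⟨_, Subalgebra.algebraMap_mem _ r, 0, zero_mem _, by simp⟩
  | add s t _ _ hs ht =>
    obtain ⟨g, hg, h, hh, rfl⟩ := hs
    obtain ⟨g', hg', h', hh', rfl⟩ := ht
    exact ⟨g + g', add_mem hg hg', h + h', add_mem hh hh', by rw [mul_add]; abel⟩
  | mul s t _ _ hs ht =>
    obtain ⟨g, hg, h, hh, rfl⟩ := hs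
    obtain ⟨g', hg', h', hh', rfl⟩ := ht
    refine ⟨g * g', mul_mem hg hg', h * g' + twist 1 g * h',
      add_mem (mul_mem hh hg') (mul_mem (twist_mem_onList hg) hh'), ?_⟩
    have h1 : gen c * (twist 1 g * h') = g * (gen c * h') := by
      rw [← mul_assoc, odd_gen_mul hc, twist_twist, mul_assoc]
    have h2 : gen c * h * (gen c * h') = 0 := by
      rw [← mul_assoc, odd_gen_mul_mul_self hc, zero_mul]
    rw [mul_add (gen c), h1, add_mul, mul_add, mul_add, h2, add_zero, mul_assoc]
    abel

/-- The product of all odd variables is a multiple of every nonzero element. -/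
theorem exists_mul_eq_prod {l : List (Idx × Idx)} (hl : ∀ c ∈ l, gpar c = 1) {t : A}
    (ht : t ∈ onList l) (h0 : t ≠ 0) : ∃ k : A, k * t = (l.map gen).prod := by
  induction l generalizing t with
  | nil =>
    have h : t ∈ (⊥ : Subalgebra ℂ A) := by simpa [onList] using ht
    obtain ⟨r, rfl⟩ := Algebra.mem_bot.1 h
    have hr : r ≠ 0 := by rintro rfl; simp at h0
    exact ⟨algebraMap ℂ A r⁻¹, by rw [← map_mul, inv_mul_cancel₀ hr]; simp⟩
  | cons c l ih =>
    have hc := hl c List.mem_cons_self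
    have hl' : ∀ d ∈ l, gpar d = 1 := fun d hd => hl d (List.mem_cons_of_mem c hd)
    obtain ⟨g, hg, h, hh, rfl⟩ := onList_cons hc ht
    rw [List.map_cons, List.prod_cons]
    by_cases hg0 : g = 0
    · subst hg0
      obtain ⟨k, hk⟩ := ih hl' hh (by rintro rfl; simp at h0)
      -- The twist on the multiplier compensates for moving it past `gen c`.
      exact ⟨twist 1 k, by rw [zero_add, ← mul_assoc, ← odd_gen_mul hc, mul_assoc, hk]⟩
    · obtain ⟨k, hk⟩ := ih hl' hg hg0
      -- The factor `gen c` kills the summand `gen c * h` and supplies the missing variable in front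
      -- of `k * g`.
      refine ⟨gen c * k, ?_⟩
      rw [mul_add, ← mul_assoc (gen c * k) (gen c) h, odd_gen_mul_mul_self hc, zero_mul, add_zero,
        mul_assoc, hk]

theorem mem_span_sublists {l : List (Idx × Idx)} (hl : ∀ c ∈ l, gpar c = 1) {t : A}
    (ht : t ∈ onList l) :
    t ∈ Submodule.span ℂ {m | ∃ l' : List (Idx × Idx), l'.Sublist l ∧ m = (l'.map gen).prod} := by
  induction l generalizing t with
  | nil =>
    have h : t ∈ (⊥ : Subalgebra ℂ A) := by simpa [onList] using ht
    obtain ⟨r, rfl⟩ := Algebra.mem_bot.1 h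
    rw [Algebra.algebraMap_eq_smul_one]
    exact Submodule.smul_mem _ r (Submodule.subset_span ⟨[], List.Sublist.refl _, by simp⟩)
  | cons c l ih =>
    have hl' : ∀ d ∈ l, gpar d = 1 := fun d hd => hl d (List.mem_cons_of_mem c hd)
    obtain ⟨g, hg, h, hh, rfl⟩ := onList_cons (hl c List.mem_cons_self) ht
    refine add_mem (Submodule.span_mono ?_ (ih hl' hg)) ?_
    · rintro _ ⟨l', hl', rfl⟩
      exact ⟨l', hl'.cons c, rfl⟩
    · have h1 := Submodule.mem_map_of_mem (f := LinearMap.mulLeft ℂ (gen c)) (ih hl' hh)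
      rw [Submodule.map_span] at h1
      refine Submodule.span_mono ?_ h1
      rintro _ ⟨_, ⟨l', hl', rfl⟩, rfl⟩
      exact ⟨c :: l', hl'.cons_cons c, by simp⟩

/-- If `D` multiplies monomials of degree `k` by `2 k`, then the part of top degree consists of
the multiples of the product of all variables. -/
theorem eq_smul_prod_of_degree {l : List (Idx × Idx)} (hl : ∀ c ∈ l, gpar c = 1)
    {D : Module.End ℂ A} (hD : ∀ l' : List (Idx × Idx), l'.Sublist l →
      D (l'.map gen).prod = ((2 * l'.length : ℕ) : ℂ) • (l'.map gen).prod)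
    {t : A} (ht : t ∈ onList l) (h : D t = ((2 * l.length : ℕ) : ℂ) • t) :
    ∃ r : ℂ, t = r • (l.map gen).prod := by
  have hspan := mem_span_sublists hl ht
  -- The roots `0, …, 2 * l.length - 1` include the eigenvalues of all shorter monomials but not the
  -- top one, so `p(D)` projects onto the top degree up to a nonzero scalar.
  set p := fallPoly (2 * l.length)
  have hp : p.eval ((2 * l.length : ℕ) : ℂ) ≠ 0 := fallPoly_eval_ne_zero _
  have key : Polynomial.aeval D p t ∈ Submodule.span ℂ {(l.map gen).prod} := by
    refine Submodule.span_induction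
      (p := fun t _ => Polynomial.aeval D p t ∈ Submodule.span ℂ {(l.map gen).prod})
      ?_ ?_ ?_ ?_ hspan
    · rintro _ ⟨l', hl', rfl⟩
      rw [aeval_eigen (hD l' hl')]
      by_cases hlen : l'.length < l.length
      · rw [fallPoly_eval_eq_zero (by omega), zero_smul]
        exact zero_mem _
      · rw [hl'.eq_of_length_le (not_lt.1 hlen)]
        exact Submodule.smul_mem _ _ (Submodule.mem_span_singleton_self _)
    · rw [map_zero]; exact zero_mem _
    · intro s t _ _ h1 h2
      rw [map_add]; exact add_mem h1 h2
    · intro r t _ h1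
      rw [map_smul]; exact Submodule.smul_mem _ r h1
  rw [aeval_eigen h] at key
  obtain ⟨r, hr⟩ := Submodule.mem_span_singleton.1 key
  refine ⟨(p.eval ((2 * l.length : ℕ) : ℂ))⁻¹ * r, ?_⟩
  rw [mul_smul, hr, inv_smul_smul₀ hp]

/-! ### The product of the variables `y_{i,j}` with `i ≤ j < n` -/

/-- The pairs `(i, j)` with `i ≤ j < n`. -/
def upperPairs (n : ℕ) : Finset (ℕ × ℕ) :=
  (Finset.range n ×ˢ Finset.range n).filter fun p => p.1 ≤ p.2

/-- The labels of the variables `y_{i,j}` with `i ≤ j < n`. -/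
def yList (n : ℕ) : List (Idx × Idx) :=
  (upperPairs n).toList.map fun p => (Sum.inl p.1, Sum.inl p.2)

/-- The product of the variables `y_{i,j}` with `i ≤ j < n`. -/
def yProd (n : ℕ) : A := ((yList n).map gen).prod

theorem mem_upperPairs {n : ℕ} {p : ℕ × ℕ} : p ∈ upperPairs n ↔ p.1 ≤ p.2 ∧ p.2 < n := by
  simp only [upperPairs, Finset.mem_filter, Finset.mem_product, Finset.mem_range]
  omega

theorem mem_yList {n : ℕ} {c : Idx × Idx} :
    c ∈ yList n ↔ ∃ i j, i ≤ j ∧ j < n ∧ c = (Sum.inl i, Sum.inl j) := by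
  simp only [yList, List.mem_map, Finset.mem_toList, mem_upperPairs]
  constructor
  · rintro ⟨⟨i, j⟩, ⟨h1, h2⟩, rfl⟩
    exact ⟨i, j, h1, h2, rfl⟩
  · rintro ⟨i, j, h1, h2, rfl⟩
    exact ⟨(i, j), ⟨h1, h2⟩, rfl⟩

/-- Matches the two kinds of degree: each `y_{i,j}` has total weight `2`, and the weight `(n+1, …,
n+1)` has total `n(n+1)`. -/
theorem two_mul_length_yList (n : ℕ) : 2 * (yList n).length = n * (n + 1) := by
  have h : (upperPairs n).card = ∑ j ∈ Finset.range n, (j + 1) := by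
    have e : ∑ j ∈ Finset.range n, (j + 1) =
        ((Finset.range n).sigma fun j => Finset.range (j + 1)).card := by simp
    rw [e]
    refine Finset.card_bij' (fun p _ => ⟨p.2, p.1⟩) (fun p _ => (p.2, p.1)) ?_ ?_ ?_ ?_
    · intro p hp
      have := mem_upperPairs.1 hp
      simp
      omega
    · rintro ⟨j, i⟩ hp
      simp at hp
      rw [mem_upperPairs]
      simp
      omega
    · intro p _; rfl
    · intro p _; rfl
  have h2 : ∑ j ∈ Finset.range n, (j + 1) = ∑ j ∈ Finset.range (n + 1), j := by
    rw [Finset.sum_range_succ' (fun j => j) n, add_zero]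
  rw [yList, List.length_map, Finset.length_toList, h, h2, mul_comm,
    Finset.sum_range_id_mul_two, Nat.add_sub_cancel, mul_comm]

theorem gpar_yList {n : ℕ} : ∀ c ∈ yList n, gpar c = 1 := by
  intro c hc
  obtain ⟨i, j, -, -, rfl⟩ := mem_yList.1 hc
  rfl

theorem onIdx_evens_le (n : ℕ) : onIdx (evens n) ≤ onList (yList n) := by
  refine Algebra.adjoin_le ?_
  rintro _ ⟨⟨_, _⟩, ⟨⟨i, hi, rfl⟩, ⟨j, hj, rfl⟩⟩, rfl⟩
  rcases le_total i j with h | h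
  · exact Algebra.subset_adjoin ⟨_, mem_yList.2 ⟨i, j, h, hj, rfl⟩, rfl⟩
  · have e : gen (Sum.inl i, Sum.inl j) = gen (Sum.inl j, Sum.inl i) := by
      rw [gen_symm]; simp [par, sgn_zero]
    change gen (Sum.inl i, Sum.inl j) ∈ _
    rw [e]
    exact Algebra.subset_adjoin ⟨_, mem_yList.2 ⟨j, i, h, hi, rfl⟩, rfl⟩

/-- Every nonzero ideal of the super tca `A` contains some `∏ y_{i,j}`. -/
theorem exists_yProd_mem {I : Ideal A} (hI : IsTcaIdeal I) (hne : I ≠ ⊥) :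
    ∃ n, 1 ≤ n ∧ yProd n ∈ I := by
  obtain ⟨t, ht, h0⟩ := Submodule.exists_mem_ne_zero_of_ne_bot hne
  obtain ⟨S, hS⟩ := exists_finset_mem_onIdx t
  obtain ⟨N, B, hNB⟩ := exists_subset_evens_union_odds S
  obtain ⟨M, u, hu, hu0, huM⟩ := exists_mem_onIdx_evens
    (W := I.restrictScalars ℂ) hI.stable B N t ht h0 (onIdx_mono hNB hS)
  -- Enlarging `M` to `M + 1` guarantees `n ≥ 1` even when `M = 0`.
  have hu' := onIdx_evens_le (M + 1) (onIdx_mono (evens_mono M.le_succ) huM)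
  obtain ⟨k, hk⟩ := exists_mul_eq_prod gpar_yList hu' hu0
  refine ⟨M + 1, by omega, ?_⟩
  rw [yProd, ← hk]
  exact I.mul_mem_left k hu

/-- An element of weight `(n + 1, …, n + 1)` is a multiple of `∏ y_{i,j}`. -/
theorem eq_smul_yProd {n : ℕ} {t : A} (h : ∀ i < n, act (Sum.inl i) (Sum.inl i) t = (n + 1 : ℂ) • t)
    (h' : ∀ b ∉ evens n, act b b t = 0) : ∃ r : ℂ, t = r • yProd n := by
  -- The sum of the weights is a derivation that multiplies each `y_{i,j}` by `2`, so it measures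
  -- the degree.
  set D : Module.End ℂ A := ∑ i ∈ Finset.range n, act (Sum.inl i) (Sum.inl i) with hDdef
  have hD1 : D 1 = 0 := by
    rw [hDdef, LinearMap.sum_apply]
    exact Finset.sum_eq_zero fun i _ => by
      simpa using act_algebraMap (Sum.inl i) (Sum.inl i) 1
  have hDmul : ∀ s t : A, D (s * t) = D s * t + s * D t := by
    intro s t
    simp only [hDdef, LinearMap.sum_apply, act_self_mul, Finset.sum_add_distrib, Finset.sum_mul,
      Finset.mul_sum]
  have hDgen : ∀ c ∈ yList n, D (gen c) = (2 : ℂ) • gen c := by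
    intro c hc
    obtain ⟨i, j, hij, hj, rfl⟩ := mem_yList.1 hc
    have hi : i < n := by omega
    simp only [hDdef, LinearMap.sum_apply, act_gen, genAct, opar_self, zero_mul, sgn_zero,
      one_smul, Finset.sum_add_distrib, Sum.inl.injEq]
    rw [Finset.sum_ite_eq, Finset.sum_ite_eq, if_pos (Finset.mem_range.2 hi),
      if_pos (Finset.mem_range.2 hj), two_smul]
  refine eq_smul_prod_of_degree (D := D) gpar_yList ?_
    (onIdx_evens_le n (mem_onIdx_of_weight_zero h')) ?_
  · intro l' hl'
    have hsub := hl'.subset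
    clear hl'
    induction l' with
    | nil => simpa using hD1
    | cons c l' ih =>
      rw [List.map_cons, List.prod_cons, hDmul, hDgen c (hsub List.mem_cons_self),
        ih fun d hd => hsub (List.mem_cons_of_mem c hd), List.length_cons, smul_mul_assoc,
        mul_smul_comm, ← add_smul]
      congr 1
      push_cast
      ring
  · rw [two_mul_length_yList, hDdef, LinearMap.sum_apply,
      Finset.sum_congr rfl fun i hi => h i (Finset.mem_range.1 hi)]
    rw [Finset.sum_const, Finset.card_range, ← Nat.cast_smul_eq_nsmul ℂ, smul_smul]
    push_cast
    rfl

/-! ### The point defined by `𝔪` -/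

/-- The values of the variables at the point. -/
def evVal : Idx × Idx → ℂ
  | (Sum.inl i, Sum.inr j) => if i = j then 1 else 0
  | (Sum.inr j, Sum.inl i) => if i = j then 1 else 0
  | _ => 0

/-- Evaluation at the point. -/
def ev : A →ₐ[ℂ] ℂ :=
  liftA evVal
    (by rintro (i | i) (j | j) <;> simp [evVal, par, sgn_zero])
    (by
      rintro ⟨i | i, j | j⟩ ⟨k | k, l | l⟩ <;> simp [evVal, gpar, par, mul_comm] <;>
        simp [CharTwo.add_self_eq_zero, sgn_zero])

theorem ev_gen (c : Idx × Idx) : ev (gen c) = evVal c := liftA_gen _ _ _ c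

theorem ev_twist (r : ZMod 2) (t : A) : ev (twist r t) = ev t := by
  induction t using A_induction with
  | hr c => simp
  | hg c =>
    rw [twist_gen, map_smul, ev_gen]
    rcases c with ⟨i | i, j | j⟩ <;> simp [evVal, gpar, par] <;>
      simp [CharTwo.add_self_eq_zero, sgn_zero]
  | hm s t hs ht => simp only [map_mul, hs, ht]
  | ha s t hs ht => simp only [map_add, hs, ht]

/-- Modulo `𝔪` every variable is congruent to its value at the point, and this passes to sums and
products. Hence an ideal with an element not vanishing at the point contains a unit modulo `𝔪`. -/
theorem sub_ev_mem (t : A) : t - algebraMap ℂ A (ev t) ∈ 𝔪 := by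
  induction t using A_induction with
  | hr r => rw [AlgHom.commutes]; simp
  | hg c =>
    rw [ev_gen]
    have hx : ∀ i j, x i j - algebraMap ℂ A (if i = j then 1 else 0) ∈ 𝔪 := by
      intro i j
      refine Ideal.subset_span (Or.inl (Or.inl ?_))
      by_cases h : i = j
      · subst h
        exact Or.inr ⟨i, by simp⟩
      · exact Or.inl ⟨i, j, h, by simp [h]⟩
    rcases c with ⟨i | i, j | j⟩
    · exact Ideal.subset_span (Or.inl (Or.inr ⟨i, j, by simp [evVal, y]⟩))
    · exact hx i j
    · have e : gen (Sum.inr i, Sum.inl j) = x j i := by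
        rw [gen_symm]; simp [par, sgn_zero, x]
      rw [e]
      exact hx j i
    · exact Ideal.subset_span (Or.inr ⟨i, j, by simp [evVal, z]⟩)
  | hm s t hs ht =>
    have e : s * t - algebraMap ℂ A (ev (s * t)) =
        s * (t - algebraMap ℂ A (ev t)) +
          algebraMap ℂ A (ev t) * (s - algebraMap ℂ A (ev s)) := by
      rw [map_mul, mul_comm (ev s), map_mul, mul_sub, mul_sub, Algebra.commutes (ev t) s]
      abel
    rw [e]
    exact add_mem (Ideal.mul_mem_left _ _ ht) (Ideal.mul_mem_left _ _ hs)
  | ha s t hs ht =>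
    rw [map_add, map_add, add_sub_add_comm]
    exact add_mem hs ht

theorem sup_𝔪_eq_top {I : Ideal A} {t : A} (ht : t ∈ I) (h : ev t ≠ 0) : I ⊔ 𝔪 = ⊤ := by
  rw [Ideal.eq_top_iff_one]
  have h1 : algebraMap ℂ A (ev t) ∈ I ⊔ 𝔪 := by
    have := sub_mem ((le_sup_left : I ≤ I ⊔ 𝔪) ht) ((le_sup_right : 𝔪 ≤ I ⊔ 𝔪) (sub_ev_mem t))
    rwa [sub_sub_cancel] at this
  have h2 := Ideal.mul_mem_left (I ⊔ 𝔪) (algebraMap ℂ A (ev t)⁻¹) h1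
  rwa [← map_mul, inv_mul_cancel₀ h, map_one] at h2

/-! ### Order of vanishing at the point -/

/-- The elements vanishing at the point to order at least `k`. -/
def vanish : ℕ → Submodule ℂ A
  | 0 => ⊤
  | k + 1 => LinearMap.ker ev.toLinearMap * vanish k

theorem mul_mem_vanish {k : ℕ} (s : A) {t : A} (ht : t ∈ vanish k) : s * t ∈ vanish k := by
  cases k with
  | zero => trivial
  | succ k =>
    rw [vanish] at ht ⊢
    induction ht using Submodule.mul_induction_on' with
    | mem_mul_mem m hm n hn =>
      rw [← mul_assoc]
      refine Submodule.mul_mem_mul ?_ hn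
      have : ev m = 0 := hm
      simp [this]
    | add u _ v _ hu hv => rw [mul_add]; exact add_mem hu hv

theorem mul_mem_vanish_succ {k : ℕ} {s t : A} (hs : ev s = 0) (ht : t ∈ vanish k) :
    s * t ∈ vanish (k + 1) :=
  Submodule.mul_mem_mul (by simpa using hs) ht

theorem ev_eq_zero_of_mem_vanish {k : ℕ} {t : A} (ht : t ∈ vanish (k + 1)) : ev t = 0 := by
  rw [vanish] at ht
  induction ht using Submodule.mul_induction_on' with
  | mem_mul_mem m hm n hn =>
    have : ev m = 0 := hm
    rw [map_mul, this, zero_mul]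
  | add u _ v _ hu hv => rw [map_add, hu, hv, add_zero]

theorem act_mem_vanish (a b : Idx) {k : ℕ} {t : A} (ht : t ∈ vanish (k + 1)) :
    act a b t ∈ vanish k := by
  induction k generalizing t with
  | zero => trivial
  | succ k ih =>
    rw [vanish] at ht
    induction ht using Submodule.mul_induction_on' with
    | mem_mul_mem m hm n hn =>
      rw [act_mul]
      refine add_mem (mul_mem_vanish _ hn) (mul_mem_vanish_succ ?_ (ih hn))
      rw [ev_twist]; exact hm
    | add u _ v _ hu hv => rw [map_add]; exact add_mem hu hv

theorem prod_mem_vanish {l : List A} (h : ∀ t ∈ l, ev t = 0) : l.prod ∈ vanish l.length := by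
  induction l with
  | nil => trivial
  | cons t l ih =>
    rw [List.prod_cons, List.length_cons]
    exact mul_mem_vanish_succ (h t List.mem_cons_self)
      (ih fun s hs => h s (List.mem_cons_of_mem t hs))

/-- A derivation normally costs one order of vanishing. Here each Leibniz term still has `l.length`
vanishing factors, so nothing is lost. -/
theorem act_prod_mem_vanish {a b : Idx} {l : List A} (h : ∀ t ∈ l, ev t = 0)
    (h' : ∀ t ∈ l, ev (act a b t) = 0) : act a b l.prod ∈ vanish l.length := by
  induction l with
  | nil => trivial
  | cons t l ih =>
    have hl := fun s hs => h s (List.mem_cons_of_mem t hs)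
    rw [List.prod_cons, List.length_cons, act_mul]
    refine add_mem (mul_mem_vanish_succ (h' t List.mem_cons_self) (prod_mem_vanish hl))
      (mul_mem_vanish_succ ?_ (ih hl fun s hs => h' s (List.mem_cons_of_mem t hs)))
    rw [ev_twist]
    exact h t List.mem_cons_self

theorem ev_act_y (i j k l : ℕ) : ev (act (Sum.inr i) (Sum.inl j) (gen (Sum.inl k, Sum.inl l))) =
    (if k = j ∧ l = i then 1 else 0) + if l = j ∧ k = i then 1 else 0 := by
  rw [act_gen, genAct]
  by_cases h1 : k = j <;> by_cases h2 : l = j <;>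
    simp [h1, h2, par, sgn_zero, ev_gen, evVal]

/-- Differentiating `∏ y_{i,j}` until it no longer vanishes at the point. -/
theorem exists_ev_ne_zero {W : Submodule ℂ A} (hW : ∀ a b, ∀ t ∈ W, act a b t ∈ W)
    {l : List (ℕ × ℕ)} (hl : ∀ p ∈ l, p.1 ≤ p.2) (hn : l.Nodup) {t : A} (ht : t ∈ W)
    (h : ∃ r : ℂ, r ≠ 0 ∧
      t - r • (l.map fun p => gen (Sum.inl p.1, Sum.inl p.2)).prod ∈ vanish (l.length + 1)) :
    ∃ u ∈ W, ev u ≠ 0 := by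
  induction l generalizing t with
  | nil =>
    obtain ⟨r, hr, h⟩ := h
    refine ⟨t, ht, ?_⟩
    have := ev_eq_zero_of_mem_vanish h
    simp [sub_eq_zero] at this
    rwa [this]
  | cons p l ih =>
    obtain ⟨r, hr, h⟩ := h
    obtain ⟨i, j⟩ := p
    have hij : i ≤ j := hl (i, j) List.mem_cons_self
    have hnot : (i, j) ∉ l := (List.nodup_cons.1 hn).1
    set Q : List A := l.map fun p => gen (Sum.inl p.1, Sum.inl p.2) with hQ
    have hQl : Q.length = l.length := by simp [hQ]
    have hQ0 : ∀ q ∈ Q, ev q = 0 := by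
      intro q hq
      obtain ⟨p, -, rfl⟩ := List.mem_map.1 hq
      simp [ev_gen, evVal]
    have hQ1 : ∀ q ∈ Q, ev (act (Sum.inr i) (Sum.inl j) q) = 0 := by
      intro q hq
      obtain ⟨⟨k, m⟩, hp, rfl⟩ := List.mem_map.1 hq
      have hkm : k ≤ m := hl (k, m) (List.mem_cons_of_mem _ hp)
      have hne : ¬ (k = i ∧ m = j) := by
        rintro ⟨rfl, rfl⟩; exact hnot hp
      -- Since `k ≤ m` and `i ≤ j`, either condition would force `(k, m) = (i, j)`, which the
      -- absence of repetitions excludes.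
      rw [ev_act_y, if_neg (by omega), if_neg (by omega), add_zero]
    set g : A := gen (Sum.inl i, Sum.inl j) with hg
    have hg0 : ev g = 0 := by simp [hg, ev_gen, evVal]
    have hc : ev (act (Sum.inr i) (Sum.inl j) g) ≠ 0 := by
      rw [hg, ev_act_y, if_pos (⟨rfl, rfl⟩ : j = j ∧ i = i)]
      -- The value is `2` on the diagonal and `1` off it.
      split_ifs <;> norm_num
    set c := ev (act (Sum.inr i) (Sum.inl j) g) with hcdef
    -- To leading order at the point, `E` applied to `r • (g * Q.prod)` is `(r * c) • Q.prod`: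
    -- replacing `E g` by its value `c` and dropping `g * E Q.prod` (up to a twist) are both errors
    -- of order `l.length + 1`.
    refine ih (fun p hp => hl p (List.mem_cons_of_mem _ hp)) (List.nodup_cons.1 hn).2
      (hW (Sum.inr i) (Sum.inl j) t ht) ⟨r * c, mul_ne_zero hr hc, ?_⟩
    rw [List.map_cons, List.prod_cons, List.length_cons] at h
    have h1 := act_mem_vanish (Sum.inr i) (Sum.inl j) h
    rw [map_sub, map_smul, act_mul] at h1
    have h2 : (act (Sum.inr i) (Sum.inl j) g - algebraMap ℂ A c) * Q.prod ∈
        vanish (l.length + 1) := by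
      rw [← hQl]
      exact mul_mem_vanish_succ (by rw [map_sub, AlgHom.commutes, ← hcdef]; simp)
        (prod_mem_vanish hQ0)
    have h3 : twist (opar (Sum.inr i) (Sum.inl j)) g * act (Sum.inr i) (Sum.inl j) Q.prod ∈
        vanish (l.length + 1) := by
      rw [← hQl]
      exact mul_mem_vanish_succ (by rw [ev_twist, hg0]) (act_prod_mem_vanish hQ0 hQ1)
    have h4 := add_mem h1 (Submodule.smul_mem _ r (add_mem h2 h3))
    convert h4 using 1
    rw [sub_mul, ← Algebra.smul_def, mul_smul]
    module

theorem exists_ev_ne_zero_of_yProd_mem {I : Ideal A} (hI : IsTcaIdeal I) {n : ℕ}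
    (h : yProd n ∈ I) : ∃ u ∈ I, ev u ≠ 0 := by
  refine exists_ev_ne_zero (W := I.restrictScalars ℂ) hI.stable
    (l := (upperPairs n).toList) ?_ (Finset.nodup_toList _) h ⟨1, one_ne_zero, ?_⟩
  · intro p hp
    exact (mem_upperPairs.1 (Finset.mem_toList.1 hp)).1
  · rw [yProd, yList, List.map_map, one_smul]
    have e : ∀ (k : ℕ) (t : A), t - t ∈ vanish k := fun k t => by
      rw [sub_self]; exact zero_mem _
    exact e _ _

/-! ### A generator of the Schur functor -/

theorem youngSymmetrizer_tensAct (μ : YoungDiagram) (a b : Idx) (t : Tens (Box μ)) :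
    youngSymmetrizer μ (tensAct a b t) = tensAct a b (youngSymmetrizer μ t) := by
  simp [youngSymmetrizer, permAct_tensAct]

theorem koszul_even {κ : Type} [Fintype κ] [LinearOrder κ] (σ : Equiv.Perm κ) {w : κ → Idx}
    (hw : ∀ c, par (w c) = 0) : koszul σ w = 0 := by
  simp [koszul, hw]

/-- On a tensor of even vectors, the Young symmetrizer is invariant under permutations of the
rows. -/
theorem youngSymmetrizer_comp (μ : YoungDiagram) {w : Box μ → Idx} (hw : ∀ c, par (w c) = 0)
    {σ : Equiv.Perm (Box μ)} (hσ : ∀ c, (σ c).row = c.row) :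
    youngSymmetrizer μ (Finsupp.single (w ∘ σ) 1) = youngSymmetrizer μ (Finsupp.single w 1) := by
  have hw' : ∀ c, par ((w ∘ σ) c) = 0 := fun c => hw (σ c)
  have hσ' : ∀ c, (σ⁻¹ c).row = c.row := fun c => by
    rw [← hσ (σ⁻¹ c)]; simp
  simp only [youngSymmetrizer, LinearMap.comp_apply]
  congr 1
  simp only [LinearMap.sum_apply, permAct_single, koszul_even _ hw, koszul_even _ hw', sgn_zero]
  -- Row symmetrization is a sum over a group, reindexed by `τ ↦ τ σ⁻¹`; even vectors produce no
  -- Koszul signs.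
  refine Finset.sum_equiv (Equiv.mulRight σ⁻¹) ?_ ?_
  · intro τ
    simp only [Finset.mem_filter, Finset.mem_univ, true_and, Equiv.coe_mulRight,
      Equiv.Perm.mul_apply]
    refine ⟨fun h c => (h _).trans (hσ' c), fun h c => ?_⟩
    have := h (σ c)
    simpa [hσ] using this
  · intro τ _
    congr 1

/-- `tensAct_single` for arbitrary decidability instances. -/
theorem tensAct_single_of_decidable {κ : Type} [Fintype κ] [LinearOrder κ] [DecidableEq κ]
    [∀ j k : κ, Decidable (j < k)] (a b : Idx) (w : κ → Idx) (r : ℂ) :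
    tensAct a b (Finsupp.single w r) = ∑ k, if w k = b then
      Finsupp.single (Function.update w k a)
        (r * sgn (opar a b * ∑ j, if j < k then par (w j) else 0)) else 0 := by
  rw [tensAct_single]
  congr!

/-- The tensor with the vector `e_i` in all boxes of row `i`. -/
def rowTensor (μ : YoungDiagram) : Tens (Box μ) :=
  Finsupp.single (fun c => Sum.inl c.row) 1

section Generate

variable {μ : YoungDiagram} {W : Submodule ℂ (Tens (Box μ))}

/-- Relabel one box `d` at a time. The operator taking `e_{d.row}` to `e_{g d}` gives one term for
each box of that row not yet relabelled. These terms differ by row permutations, so the Young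
symmetrizer identifies them and a positive multiple of the desired tensor appears. -/
theorem youngSymmetrizer_even_mem (hW : ∀ a b, ∀ t ∈ W, tensAct a b t ∈ W)
    (h : youngSymmetrizer μ (rowTensor μ) ∈ W) {g : Box μ → ℕ} (hg : ∀ c d : Box μ, g c ≠ d.row)
    (C : Finset (Box μ)) :
    youngSymmetrizer μ (Finsupp.single (fun c => if c ∈ C then Sum.inl (g c) else Sum.inl c.row) 1)
      ∈ W := by
  induction C using Finset.induction_on with
  | empty => simpa [rowTensor] using h
  | insert d C hd ih =>
    set w : Box μ → Idx := fun c => if c ∈ C then Sum.inl (g c) else Sum.inl c.row with hw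
    set w' : Box μ → Idx := fun c => if c ∈ insert d C then Sum.inl (g c) else Sum.inl c.row
      with hw'
    have hw'0 : ∀ c, par (w' c) = 0 := by
      intro c; simp only [hw']; split_ifs <;> rfl
    have hmem : ∀ k, w k = Sum.inl d.row ↔ k ∉ C ∧ k.row = d.row := by
      intro k
      by_cases hk : k ∈ C <;> simp [hw, hk, hg]
    have h1 := hW (Sum.inl (g d)) (Sum.inl d.row) _ ih
    rw [← youngSymmetrizer_tensAct, tensAct_single_of_decidable, map_sum] at h1
    have h2 : ∀ k, youngSymmetrizer μ (if w k = Sum.inl d.row then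
        Finsupp.single (Function.update w k (Sum.inl (g d)))
          ((1 : ℂ) * sgn (opar (Sum.inl (g d)) (Sum.inl d.row) *
            ∑ j, if j < k then par (w j) else 0)) else 0) =
        if w k = Sum.inl d.row then youngSymmetrizer μ (Finsupp.single w' 1) else 0 := by
      intro k
      split_ifs with hk
      · obtain ⟨hkC, hkd⟩ := (hmem k).1 hk
        have e : Function.update w k (Sum.inl (g d)) = w' ∘ Equiv.swap k d := by
          funext c
          by_cases hck : c = k
          · subst hck; simp [hw']
          · rw [Function.update_of_ne hck, Function.comp_apply]
            by_cases hcd : c = d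
            · subst hcd
              rw [Equiv.swap_apply_right]
              simp [hw, hw', hd, hkC, hkd, Ne.symm hck]
            · rw [Equiv.swap_apply_of_ne_of_ne hck hcd]
              simp [hw, hw', hcd]
        have hs : opar (Sum.inl (g d)) (Sum.inl d.row) = 0 := by simp [opar, par]
        rw [hs, zero_mul, sgn_zero, mul_one, e, youngSymmetrizer_comp μ hw'0]
        intro c
        by_cases hck : c = k
        · subst hck; rw [Equiv.swap_apply_left, hkd]
        · by_cases hcd : c = d
          · subst hcd; rw [Equiv.swap_apply_right, hkd]
          · rw [Equiv.swap_apply_of_ne_of_ne hck hcd]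
      · exact map_zero _
    rw [Finset.sum_congr rfl fun k _ => h2 k, ← Finset.sum_filter, Finset.sum_const,
      ← Nat.cast_smul_eq_nsmul ℂ] at h1
    refine (W.smul_mem_iff ?_).1 h1
    have : d ∈ Finset.univ.filter fun k => w k = Sum.inl d.row :=
      Finset.mem_filter.2 ⟨Finset.mem_univ d, (hmem d).2 ⟨hd, rfl⟩⟩
    exact_mod_cast (Finset.card_pos.2 ⟨d, this⟩).ne'

/-- Once the boxes carry distinct labels foreign to `w`, each elementary operator affects a single
box, so any `w` is reached up to a sign, odd vectors included. -/
theorem youngSymmetrizer_single_mem (hW : ∀ a b, ∀ t ∈ W, tensAct a b t ∈ W) {w : Box μ → Idx}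
    {g : Box μ → ℕ} (hg : Function.Injective g) (hgw : ∀ c d : Box μ, w c ≠ Sum.inl (g d))
    (h : youngSymmetrizer μ (Finsupp.single (fun c => Sum.inl (g c)) 1) ∈ W)
    (C : Finset (Box μ)) :
    youngSymmetrizer μ (Finsupp.single (fun c => if c ∈ C then w c else Sum.inl (g c)) 1) ∈ W := by
  induction C using Finset.induction_on with
  | empty => simpa using h
  | insert d C hd ih =>
    set v : Box μ → Idx := fun c => if c ∈ C then w c else Sum.inl (g c) with hv
    have hmem : ∀ k, v k = Sum.inl (g d) ↔ k = d := by
      intro k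
      by_cases hk : k ∈ C
      · have : k ≠ d := by rintro rfl; exact hd hk
        simp [hv, hk, hgw, this]
      · simp [hv, hk, hg.eq_iff]
    have h1 := hW (w d) (Sum.inl (g d)) _ ih
    rw [← youngSymmetrizer_tensAct, tensAct_single_of_decidable] at h1
    simp only [hmem, Finset.sum_ite_eq', Finset.mem_univ, if_true] at h1
    have e : Function.update v d (w d) =
        fun c => if c ∈ insert d C then w c else Sum.inl (g c) := by
      funext c
      by_cases hcd : c = d
      · subst hcd; simp
      · rw [Function.update_of_ne hcd]; simp [hv, hcd]
    rw [e, one_mul, ← mul_one (sgn _), ← smul_eq_mul, ← Finsupp.smul_single, map_smul] at h1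
    refine (W.smul_mem_iff ?_).1 h1
    intro h0
    simpa [h0] using sgn_mul_self (opar (w d) (Sum.inl (g d)) * ∑ j, if j < d then par (v j) else 0)

/-- The Schur functor is generated by the image of `rowTensor`. -/
theorem schur_le (hW : ∀ a b, ∀ t ∈ W, tensAct a b t ∈ W)
    (h : youngSymmetrizer μ (rowTensor μ) ∈ W) : schur μ ≤ W := by
  rintro _ ⟨t, rfl⟩
  induction t using Finsupp.induction_linear with
  | zero => rw [map_zero]; exact zero_mem _
  | add s t hs ht => rw [map_add]; exact add_mem hs ht
  | single w r =>
    rw [← mul_one r, ← smul_eq_mul, ← Finsupp.smul_single, map_smul]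
    refine W.smul_mem r ?_
    obtain ⟨N, hN⟩ : ∃ N : ℕ, ∀ c : Box μ, c.row < N ∧ ∀ i, w c = Sum.inl i → i < N := by
      refine ⟨(Finset.univ.sup fun c : Box μ => max c.row (Sum.elim id (fun _ => 0) (w c))) + 1,
        fun c => ?_⟩
      have := Finset.le_sup (f := fun c : Box μ => max c.row (Sum.elim id (fun _ => 0) (w c)))
        (Finset.mem_univ c)
      refine ⟨by omega, fun i hi => ?_⟩
      simp only [hi, Sum.elim_inl, id] at this
      omega
    -- Distinct labels beyond all rows and all even indices in `w` serve as an intermediate stage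
    -- between `rowTensor` and `w`.
    set g : Box μ → ℕ := fun c => N + (Fintype.equivFin (Box μ) c : ℕ) with hgdef
    have hg : Function.Injective g := by
      intro c d hcd
      exact (Fintype.equivFin (Box μ)).injective (Fin.ext (by simpa [hgdef] using hcd))
    have h1 := youngSymmetrizer_even_mem hW h (g := g)
      (fun c d hcd => by have := (hN d).1; simp only [hgdef] at hcd; omega) Finset.univ
    simp only [Finset.mem_univ, if_true] at h1
    have h2 := youngSymmetrizer_single_mem hW (w := w) hg
      (fun c d hcd => by have := (hN c).2 _ hcd; simp only [hgdef] at this; omega) h1 Finset.univ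
    simpa using h2

end Generate

/-! ### The weight of `rowTensor` and the ideal `𝔭 n` -/

theorem tensAct_self_rowTensor (μ : YoungDiagram) (b : Idx) :
    tensAct b b (rowTensor μ) =
      ((Finset.univ.filter fun c : Box μ => Sum.inl c.row = b).card : ℂ) • rowTensor μ := by
  have h : ∀ k : Box μ, (if Sum.inl k.row = b then
      (Finsupp.single (Function.update (fun c : Box μ => (Sum.inl c.row : Idx)) k b) (1 : ℂ)) else 0) =
      if Sum.inl k.row = b then rowTensor μ else 0 := by
    intro k
    split_ifs with hk
    · subst hk
      rw [rowTensor]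
      congr 1
      exact Function.update_eq_self k _
    · rfl
  rw [rowTensor, tensAct_single_of_decidable, opar_self]
  simp only [zero_mul, sgn_zero, mul_one]
  rw [Finset.sum_congr rfl fun k _ => h k, ← Finset.sum_filter, Finset.sum_const,
    Nat.cast_smul_eq_nsmul]
  rfl

theorem card_row_rect {n k i : ℕ} (hi : i < n) :
    (Finset.univ.filter fun c : Box (rect n k) => (Sum.inl c.row : Idx) = Sum.inl i).card = k := by
  refine Eq.trans ?_ (Finset.card_range k)
  refine Finset.card_bij' (fun c _ => c.col)
    (fun j hj => ⟨toLex (i, j), by simpa [rect, hi] using hj⟩) ?_ ?_ ?_ ?_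
  · rintro ⟨c, hc⟩ _
    simp only [rect, Finset.mem_product] at hc
    exact hc.2
  · intro j _
    simp [Box.row]
  · rintro ⟨c, hc⟩ h
    simp only [Finset.mem_filter, Finset.mem_univ, true_and, Sum.inl.injEq] at h
    subst h
    rfl
  · intro j _
    rfl

/-- The image of every morphism from the Schur functor of the rectangle is contained in every
ideal of the super tca which contains `∏ y_{i,j}`. -/
theorem 𝔭_le_of_yProd_mem {I : Ideal A} (hI : IsTcaIdeal I) {n : ℕ} (h : yProd n ∈ I) :
    𝔭 n ≤ I := by
  set μ := rect n (n + 1)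
  refine Ideal.span_le.2 ?_
  change schurPart μ _ ≤ I.restrictScalars ℂ
  refine iSup₂_le fun φ hφ => ?_
  -- The preimage of `I` under `φ`, viewed in the tensor power; it is a subrepresentation, so it is
  -- all of `schur μ` once it contains the generator.
  set W : Submodule ℂ (Tens (Box μ)) := ((I.restrictScalars ℂ).comap φ).map (schur μ).subtype
  have hW : ∀ a b, ∀ t ∈ W, tensAct a b t ∈ W := by
    rintro a b _ ⟨s, hs, rfl⟩
    refine ⟨schurAct μ a b s, ?_, rfl⟩
    change φ _ ∈ I
    rw [hφ.equivariant]
    exact hI.stable a b _ hs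
  set s : schur μ := ⟨youngSymmetrizer μ (rowTensor μ), ⟨_, rfl⟩⟩
  have hs : ∀ b, act b b (φ s) =
      ((Finset.univ.filter fun c : Box μ => Sum.inl c.row = b).card : ℂ) • φ s := by
    intro b
    rw [← hφ.equivariant, ← map_smul]
    congr 1
    apply Subtype.ext
    change tensAct b b (youngSymmetrizer μ (rowTensor μ)) = _ • youngSymmetrizer μ (rowTensor μ)
    rw [← youngSymmetrizer_tensAct, tensAct_self_rowTensor, map_smul]
  -- Each `e_i` with `i < n` fills the `n + 1` boxes of its row and no other basis vector occurs.
  -- The scalar `r` may be zero, which does no harm.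
  obtain ⟨r, hr⟩ : ∃ r : ℂ, φ s = r • yProd n := by
    refine eq_smul_yProd (fun i hi => ?_) fun b hb => ?_
    · rw [hs, card_row_rect hi]
      push_cast
      rfl
    · rw [hs, Finset.filter_false_of_mem, Finset.card_empty, Nat.cast_zero, zero_smul]
      rintro ⟨c, hc⟩ _ rfl
      simp only [μ, rect, Finset.mem_product, Finset.mem_range] at hc
      exact hb ⟨_, hc.1, rfl⟩
  have hsW : youngSymmetrizer μ (rowTensor μ) ∈ W := by
    refine ⟨s, ?_, rfl⟩
    change φ s ∈ I
    rw [hr]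
    exact (I.restrictScalars ℂ).smul_mem r h
  rintro _ ⟨u, rfl⟩
  obtain ⟨u', hu', he⟩ := schur_le hW hsW u.2
  have : u' = u := Subtype.ext he
  subst this
  exact hu'

end SuperTca

end

theorem corollary2p6 (𝔞 : Ideal SuperTca.A) (h𝔞 : SuperTca.IsTcaIdeal 𝔞) (hne : 𝔞 ≠ ⊥) :
    (∃ n : ℕ, 1 ≤ n ∧ SuperTca.𝔭 n ≤ 𝔞) ∧ 𝔞 ⊔ SuperTca.𝔪 = ⊤ := by
  obtain ⟨n, hn, h⟩ := SuperTca.exists_yProd_mem h𝔞 hne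
  obtain ⟨u, hu, hev⟩ := SuperTca.exists_ev_ne_zero_of_yProd_mem h𝔞 h
  exact ⟨⟨n, hn, SuperTca.𝔭_le_of_yProd_mem h𝔞 h⟩, SuperTca.sup_𝔪_eq_top hu hev⟩
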